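/- Let $V$ be a two-sided quaternionic Banach space, i.e. a real Banach space with commuting left and right $\mathbb H$-vector space structures extending the real one and $\|av\|=|a|\|v\|=\|va\|$ for $a\in\mathbb H$. Let $T:\mathcal D(T)\subseteq V\to V$ be a closed right $\mathbb H$-linear operator. For $s\in\mathbb H$ put $\mathcal Q_s(T)=T^2-2\,\mathrm{Re}(s)T+|s|^2\mathcal I$ on $\mathcal D(T^2)$, let $\rho_S(T)$ be the set of $s$ for which $\mathcal Q_s(T)$ has a bounded everywhere defined inverse, and for $s\in\rho_S(T)$, $m\in\mathbb N$, put $$S_R^{-1}(s,T)=-(T-\mathcal I\overline s)\mathcal Q_s(T)^{-1},\qquad S_R^{-m}(s,T)=\sum_{k=0}^m\binom mk\overline s^{\,m-k}(-T)^k\mathcal Q_s(T)^{-m}.$$ Assume that $(-\infty,0]\subset\rho_S(T)$ and that there is $M>0$ with $\|S_R^{-1}(s,T)\|\le M/(1+|s|)$ for $s\in(-\infty,0]$. For $\alpha>0$ the operator $T^{-\alpha}$ is defined as follows. Let $\arg(p)=\arccos(\mathrm{Re}(p)/|p|)$ and, for $s\in\mathbb H\setminus(-\infty,0]$, $s^{-\alpha}=e^{-\alpha(\ln|s|+I_s\arg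 s)}$ with $I_s=\underline s/|\underline s|$, where $\underline s$ is the imaginary part of $s$ ($I_s$ arbitrary if $\underline s=0$). There are $a_0>0$, $\theta_0\in(0,\pi)$ such that the closed sector $\Sigma=\{s:\ s=a_0\text{ or }\arg(s-a_0)\ge\theta_0\}$ is contained in $\rho_S(T)$ and $\|S_R^{-1}(s,T)\|\le M'/(1+|s|)$ on $\Sigma$ for some $M'>0$. For such a sector, an imaginary unit $I$ ($\mathrm{Re}\,I=0$, $|I|=1$), $\theta\in(\theta_0,\pi)$ and a piecewise continuously differentiable path $\Gamma$ in $(\Sigma\cap\mathbb C_I)\setminus(-\infty,0]$, $\mathbb C_I=\mathbb R+I\mathbb R$, going from $\infty e^{I\theta}$ to $\infty e^{-I\theta}$, set $$T^{-\alpha}=\frac1{2\pi}\int_\Gamma s^{-\alpha}\,ds_I\,S_R^{-1}(s,T),\qquad ds_I=-I\,ds,$$ as a (possibly improper) integral converging in operator norm; such paths exist in every $\mathbb C_I$, and the integral does not depend on the choice of sector, $I$, $\theta$ and $\Gamma$. Then for every integer $n\ge0$ and every non-integer $\alpha\in(0,n+1)$, $$T^{-\alpha}=(-1)^{n+1}\,\frac{\sin(\alpha\pi)}{\pi}\,\frac{n!}{(n-\alpha)(n-1-\alpha)\cdots(1-\alpha)}\int_0^{\infty}t^{n-\alpha}S_R^{-(n+1)}(-t,T)\,dt,$$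 where the product in the denominator is $1$ if $n=0$ and the integral converges absolutely in operator norm. In particular, for $\alpha\in(0,1)$, $$T^{-\alpha}=-\frac{\sin(\alpha\pi)}{\pi}\int_0^{\infty}t^{-\alpha}S_R^{-1}(-t,T)\,dt,$$ again with an absolutely convergent integral. -/

import Mathlib

open scoped Quaternion
open Filter Topology MeasureTheory

noncomputable section

set_option linter.unusedSectionVars false

namespace QuatOp

/-! ### Quaternions -/

/-- The sphere of imaginary units `I`, i.e. `Re I = 0` and `|I| = 1`. -/
def imagUnits : Set ℍ[ℝ] := {I | I.re = 0 ∧ ‖I‖ = 1}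

/-- The complex plane `ℂ_I = {x + I y}`. -/
def slicePlane (I : ℍ[ℝ]) : Set ℍ[ℝ] := {s | ∃ x y : ℝ, s = (x : ℍ[ℝ]) + I * (y : ℍ[ℝ])}

/-- The half line `(-∞, 0]` inside the quaternions. -/
def negHalfLine : Set ℍ[ℝ] := {s | ∃ r : ℝ, r ≤ 0 ∧ s = (r : ℍ[ℝ])}

/-- The argument of `p ≠ 0`: the number `θ ∈ [0, π]` with `p = |p| exp (θ I_p)`. -/
def qarg (p : ℍ[ℝ]) : ℝ := Real.arccos (p.re / ‖p‖)

/-- The imaginary unit `I_p = Im p / |Im p|` of a non-real `p`. For real `p` the value is `0`;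
this choice is irrelevant below, where `I_p` is multiplied by `qarg p = 0` when `p > 0`. -/
def qunit (p : ℍ[ℝ]) : ℍ[ℝ] := ‖p.im‖⁻¹ • p.im

/-- The logarithm `log s = ln |s| + I_s arccos (Re s / |s|)` on `ℍ ∖ (-∞, 0]`. -/
def qlog (s : ℍ[ℝ]) : ℍ[ℝ] := (Real.log ‖s‖ : ℍ[ℝ]) + qunit s * (qarg s : ℍ[ℝ])

/-- The power `s ^ α = exp (α log s)` on `ℍ ∖ (-∞, 0]`, for real `α`. -/
def qpow (s : ℍ[ℝ]) (α : ℝ) : ℍ[ℝ] := NormedSpace.exp (α • qlog s)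

/-- The closed sector `{s : arg (s - a) ≥ θ}` with apex `a` (the apex included). -/
def closedSector (θ a : ℝ) : Set ℍ[ℝ] :=
  {s | s = (a : ℍ[ℝ]) ∨ θ ≤ qarg (s - (a : ℍ[ℝ]))}

/-- A piecewise continuously differentiable path: `Γ` is `C¹` on every compact interval whose
interior contains none of finitely many break points. -/
def PiecewiseC1 (Γ : ℝ → ℍ[ℝ]) : Prop :=
  ∃ P : Finset ℝ, ∀ a b : ℝ, a < b → (∀ t ∈ P, t ∉ Set.Ioo a b) →
    ContDiffOn ℝ 1 Γ (Set.Icc a b)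

/-! ### Operators on a two-sided quaternionic Banach space

The left scalar multiplication is the action of `ℍ`, the right scalar multiplication is the
action of the opposite ring `ℍᵐᵒᵖ`. Partially defined right linear operators are
`V →ₗ.[ℍ[ℝ]ᵐᵒᵖ] V` and bounded right linear operators are `V →L[ℍ[ℝ]ᵐᵒᵖ] V`. -/

variable {V : Type*} [NormedAddCommGroup V] [NormedSpace ℝ V]
  [Module ℍ[ℝ] V] [Module ℍ[ℝ]ᵐᵒᵖ V] [SMulCommClass ℍ[ℝ]ᵐᵒᵖ ℍ[ℝ] V]
  [IsScalarTower ℝ ℍ[ℝ] V] [IsScalarTower ℝ ℍ[ℝ]ᵐᵒᵖ V]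
  [NormSMulClass ℍ[ℝ] V] [NormSMulClass ℍ[ℝ]ᵐᵒᵖ V]

/-- The square `T²`, with domain `{v ∈ D(T) : T v ∈ D(T)}`. -/
def opSq (T : V →ₗ.[ℍ[ℝ]ᵐᵒᵖ] V) : V →ₗ.[ℍ[ℝ]ᵐᵒᵖ] V where
  domain := (T.domain.comap T.toFun).map T.domain.subtype
  toFun :=
    { toFun := fun v => T ⟨T ⟨v.1, by
          obtain ⟨w, -, hw⟩ := v.2
          exact hw ▸ w.2⟩, by
          obtain ⟨w, hw, hwv⟩ := v.2
          have : w = ⟨v.1, hwv ▸ w.2⟩ := Subtype.ext hwv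
          exact this ▸ hw⟩
      map_add' := fun v w => by
        rw [← LinearPMap.map_add]
        congr 1
        apply Subtype.ext
        exact T.map_add ⟨v.1, _⟩ ⟨w.1, _⟩
      map_smul' := fun c v => by
        rw [RingHom.id_apply, ← LinearPMap.map_smul]
        congr 1
        apply Subtype.ext
        exact T.map_smul c ⟨v.1, _⟩ }

/-- The identity as an everywhere defined operator. -/
def opId : V →ₗ.[ℍ[ℝ]ᵐᵒᵖ] V := (LinearMap.id : V →ₗ[ℍ[ℝ]ᵐᵒᵖ] V).toPMap ⊤

/-- The operator `T² - 2 Re(s) T + |s|² I`, with domain `D(T²)`. -/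
def opQ (s : ℍ[ℝ]) (T : V →ₗ.[ℍ[ℝ]ᵐᵒᵖ] V) : V →ₗ.[ℍ[ℝ]ᵐᵒᵖ] V :=
  opSq T - (2 * s.re) • T + (‖s‖ ^ 2) • opId

/-- `B` is a bounded everywhere defined two-sided inverse of the operator `P`. -/
def IsBoundedInverse (P : V →ₗ.[ℍ[ℝ]ᵐᵒᵖ] V) (B : V →L[ℍ[ℝ]ᵐᵒᵖ] V) : Prop :=
  (∀ v : V, ∃ h : B v ∈ P.domain, P ⟨B v, h⟩ = v) ∧ ∀ w : P.domain, B (P w) = w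

/-- The `S`-resolvent set of `T`. -/
def sResolventSet (T : V →ₗ.[ℍ[ℝ]ᵐᵒᵖ] V) : Set ℍ[ℝ] :=
  {s | ∃ B : V →L[ℍ[ℝ]ᵐᵒᵖ] V, IsBoundedInverse (opQ s T) B}

open Classical in
/-- The pseudo-resolvent `(T² - 2 Re(s) T + |s|² I)⁻¹` for `s` in the `S`-resolvent set
(and `0` for other `s`). -/
def pseudoResolvent (s : ℍ[ℝ]) (T : V →ₗ.[ℍ[ℝ]ᵐᵒᵖ] V) : V →L[ℍ[ℝ]ᵐᵒᵖ] V :=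
  if h : s ∈ sResolventSet T then h.choose else 0

theorem pseudoResolvent_spec {s : ℍ[ℝ]} {T : V →ₗ.[ℍ[ℝ]ᵐᵒᵖ] V} (h : s ∈ sResolventSet T) :
    IsBoundedInverse (opQ s T) (pseudoResolvent s T) := by
  rw [pseudoResolvent, dif_pos h]
  exact h.choose_spec

open Classical in
/-- The product `T B` of an operator `T` and a bounded operator `B`, when it is everywhere defined
and bounded (and `0` otherwise). For closed `T` this is the case as soon as `B` maps `V` into
`D(T)`, see `opMul_apply`. -/
def opMul (T : V →ₗ.[ℍ[ℝ]ᵐᵒᵖ] V) (B : V →L[ℍ[ℝ]ᵐᵒᵖ] V) : V →L[ℍ[ℝ]ᵐᵒᵖ] V :=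
  if h : ∃ C : V →L[ℍ[ℝ]ᵐᵒᵖ] V, ∀ v : V, ∃ hv : B v ∈ T.domain, C v = T ⟨B v, hv⟩
  then h.choose else 0

theorem opMul_apply [CompleteSpace V] {T : V →ₗ.[ℍ[ℝ]ᵐᵒᵖ] V} (hT : IsClosed (T.graph : Set (V × V)))
    {B : V →L[ℍ[ℝ]ᵐᵒᵖ] V} (hB : ∀ v, B v ∈ T.domain) (v : V) :
    opMul T B v = T ⟨B v, hB v⟩ := by
  have key : ∃ C : V →L[ℍ[ℝ]ᵐᵒᵖ] V, ∀ v : V, ∃ hv : B v ∈ T.domain, C v = T ⟨B v, hv⟩ := by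
    let f : V →ₗ[ℍ[ℝ]ᵐᵒᵖ] V := T.toFun.comp (B.toLinearMap.codRestrict T.domain hB)
    have hg : IsClosed ((f.restrictScalars ℝ).graph : Set (V × V)) := by
      have : ((f.restrictScalars ℝ).graph : Set (V × V))
          = (fun p : V × V => (B p.1, p.2)) ⁻¹' (T.graph : Set (V × V)) := by
        ext p
        simp only [SetLike.mem_coe, LinearMap.mem_graph_iff, Set.mem_preimage,
          LinearPMap.mem_graph_iff, LinearMap.restrictScalars_apply]
        constructor
        · intro h
          exact ⟨⟨B p.1, hB p.1⟩, rfl, h.symm⟩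
        · rintro ⟨w, hw, hw'⟩
          have : w = ⟨B p.1, hB p.1⟩ := Subtype.ext hw
          subst this
          exact hw'.symm
      rw [this]
      exact hT.preimage (by fun_prop)
    exact ⟨⟨f, (ContinuousLinearMap.ofIsClosedGraph hg).continuous⟩, fun v => ⟨hB v, rfl⟩⟩
  rw [opMul, dif_pos key]
  exact (key.choose_spec v).2

/-- The right `S`-resolvent `S_R⁻¹(s, T) = -(T - s̄ I) (T² - 2 Re(s) T + |s|² I)⁻¹`. -/
def sResolventR (s : ℍ[ℝ]) (T : V →ₗ.[ℍ[ℝ]ᵐᵒᵖ] V) : V →L[ℍ[ℝ]ᵐᵒᵖ] V :=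
  -(opMul T (pseudoResolvent s T) - star s • pseudoResolvent s T)

/-- The powers
`S_R⁻ⁿ(s, T) = ∑ k ≤ n, (n choose k) s̄ⁿ⁻ᵏ (-T)ᵏ (T² - 2 Re(s) T + |s|² I)⁻ⁿ`. -/
def sResolventRPow (n : ℕ) (s : ℍ[ℝ]) (T : V →ₗ.[ℍ[ℝ]ᵐᵒᵖ] V) : V →L[ℍ[ℝ]ᵐᵒᵖ] V :=
  ∑ k ∈ Finset.range (n + 1),
    n.choose k • (star s) ^ (n - k) • (opMul (-T))^[k] (pseudoResolvent s T ^ n)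

/-- The standing assumption on `T`: it is closed, `(-∞, 0] ⊆ ρ_S(T)`, and
`‖S_R⁻¹(s, T)‖ ≤ M / (1 + |s|)` on `(-∞, 0]` for some `M > 0`. Restriction of scalars to `ℝ`
only serves to obtain the operator norm. -/
structure IsPositiveType (T : V →ₗ.[ℍ[ℝ]ᵐᵒᵖ] V) : Prop where
  closed : IsClosed (T.graph : Set (V × V))
  subset : negHalfLine ⊆ sResolventSet T
  bound : ∃ M : ℝ, 0 < M ∧ ∀ s ∈ negHalfLine,
    ‖(sResolventR s T).restrictScalars ℝ‖ ≤ M / (1 + ‖s‖)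

/-- The closed sector with angle `θ₀ ∈ (0, π)` and apex `a₀ > 0` lies in `ρ_S(T)` and
`‖S_R⁻¹(s, T)‖ ≤ M / (1 + |s|)` holds on it for some `M > 0`. -/
def IsResolventSector (T : V →ₗ.[ℍ[ℝ]ᵐᵒᵖ] V) (θ₀ a₀ : ℝ) : Prop :=
  0 < a₀ ∧ 0 < θ₀ ∧ θ₀ < Real.pi ∧ closedSector θ₀ a₀ ⊆ sResolventSet T ∧
    ∃ M : ℝ, 0 < M ∧ ∀ s ∈ closedSector θ₀ a₀,
      ‖(sResolventR s T).restrictScalars ℝ‖ ≤ M / (1 + ‖s‖)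

/-- `Γ` is an admissible path in `ℂ_I` for the definition of `T^{-α}`: for some resolvent sector
and some `θ ∈ (θ₀, π)` it is a piecewise smooth path in the sector within `ℂ_I ∖ (-∞, 0]` that
goes from `∞ exp(I θ)` to `∞ exp(-I θ)`. -/
def IsAdmissiblePath (T : V →ₗ.[ℍ[ℝ]ᵐᵒᵖ] V) (I : ℍ[ℝ]) (Γ : ℝ → ℍ[ℝ]) : Prop :=
  ∃ θ₀ a₀ θ : ℝ, IsResolventSector T θ₀ a₀ ∧ θ₀ < θ ∧ θ < Real.pi ∧
    PiecewiseC1 Γ ∧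
    (∀ t, Γ t ∈ (closedSector θ₀ a₀ ∩ slicePlane I) \ negHalfLine) ∧
    Tendsto (fun t => ‖Γ t‖) atBot atTop ∧
    Tendsto (fun t => ‖Γ t‖⁻¹ • Γ t) atBot (𝓝 (NormedSpace.exp (θ • I))) ∧
    Tendsto (fun t => ‖Γ t‖) atTop atTop ∧
    Tendsto (fun t => ‖Γ t‖⁻¹ • Γ t) atTop (𝓝 (NormedSpace.exp (-(θ • I))))

/-- The part over `[a, b]` of the integral `(1 / 2π) ∫_Γ s^{-α} ds_I S_R⁻¹(s, T)`, where
`ds_I = -I ds`. -/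
def fracPowIntegral (T : V →ₗ.[ℍ[ℝ]ᵐᵒᵖ] V) (α : ℝ) (I : ℍ[ℝ]) (Γ : ℝ → ℍ[ℝ]) (a b : ℝ) :
    V →L[ℝ] V :=
  (1 / (2 * Real.pi)) • ∫ t in a..b,
    ((qpow (Γ t) (-α) * (-I * deriv Γ t)) • sResolventR (Γ t) T).restrictScalars ℝ

/-- `A` is the operator `T^{-α} = (1 / 2π) ∫_Γ s^{-α} ds_I S_R⁻¹(s, T)`: admissible paths exist in
every plane `ℂ_I`, and for every imaginary unit `I` and every admissible path `Γ` in `ℂ_I` the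
(improper) integral converges to `A` in operator norm. Such an `A` is unique. -/
def IsNegFracPow (T : V →ₗ.[ℍ[ℝ]ᵐᵒᵖ] V) (α : ℝ) (A : V →L[ℝ] V) : Prop :=
  ∀ I ∈ imagUnits, (∃ Γ, IsAdmissiblePath T I Γ) ∧
    ∀ Γ, IsAdmissiblePath T I Γ →
      Tendsto (fun p : ℝ × ℝ => fracPowIntegral T α I Γ p.1 p.2) (atBot ×ˢ atTop) (𝓝 A)

end QuatOp

end

noncomputable section

set_option linter.unusedSectionVars false

namespace QuatOp

/-! ### Radial primitives of holomorphic functions -/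

section Radial

variable {W : Type*} [NormedAddCommGroup W] [NormedSpace ℂ W]

/-! Since `0 ∈ ρ_S(T)`, the operator `T` has a bounded inverse `A`, and everything can be expressed
through it: `Q_s(T)⁻¹ = A² q_s(A)⁻¹` with `q_s(A) = 1 - 2 Re(s) A + |s|² A²`. Fix an imaginary unit
`I`. The bounded real operators on `V`, with left multiplication by `ℂ_I` as scalar action, form a
complex Banach space with a ring structure in which `(z f) g = z (f g)`, although `f (z g) = z (f
g)` fails for non-real `z`. This is enough: because `q_z(A)` has real coefficients, `F(z) = (z̄ A -
1) A q_z(A)⁻¹`, which is `S_R⁻¹(z, T)`, is holomorphic in `z` (`hasDerivAt_resolventFun`). The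
problem becomes one about a holomorphic function with values in a complex Banach space.

No contour is deformed. An explicit primitive of `z^{-α} F(z)` is used instead: integration by parts
`n` times leaves `z^{n-α} F⁽ⁿ⁾(z)`, and a primitive of the latter is `z^{n-α+1} ∫₀¹ r^{n-α} F⁽ⁿ⁾(r
z) dr`, which makes sense because the sector is star-shaped about `0` and `n - α > -1`
(`hasDerivAt_fracPrimitive`). At infinity the Cauchy estimates `‖F⁽ᵏ⁾(z)‖ ≤ C / |z|^{k+1}` kill the
boundary terms. Turning the radial term along an arc to the cut costs `O(|z|^{-α})`, so its limits
at the two ends of the path are `e^{±iπ(n-α+1)} ∫₀^∞ ρ^{n-α} F⁽ⁿ⁾(-ρ) dρ`. Their difference produces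
the sine. Only the ends of the path matter, so the value is the same for all admissible paths
(`tendsto_contourIntegral`).

On the cut, put `R(t) = A (1 + t A)⁻¹`. Then `F(-t) = -R(t)` and `R' = -R²`, so `F⁽ⁿ⁾(-t) = -n!
R(t)^{n+1}`, while the binomial theorem turns the defining sum of `S_R^{-m}(-t, T)` into `(-1)^m
R(t)^m`. Comparing the two gives the formula. That a resolvent sector exists at all follows by
perturbing around the points `-t` (`isUnit_quadElem_and_norm_le`). -/

/-- The weighted radial mean `∫₀¹ r ^ β g (r z) dr`. -/
def radialIntegral (β : ℝ) (g : ℂ → W) (z : ℂ) : W :=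
  ∫ r in (0 : ℝ)..1, (r ^ β) • g (r * z)

theorem continuousOn_comp_segment {U : Set ℂ} {g : ℂ → W} (hg : ContinuousOn g U) {z : ℂ}
    (hz : ∀ r ∈ Set.Icc (0 : ℝ) 1, (r : ℂ) * z ∈ U) :
    ContinuousOn (fun r : ℝ => g (r * z)) (Set.Icc 0 1) :=
  hg.comp (by fun_prop) fun r hr => hz r hr

theorem continuousOn_rpow_smul {β : ℝ} {f : ℝ → W} (hf : ContinuousOn f (Set.Icc 0 1)) :
    ContinuousOn (fun r : ℝ => (r ^ β) • f r) (Set.Ioc 0 1) := by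
  have h : ContinuousOn (fun r : ℝ => r ^ β) (Set.Ioc 0 1) := fun r hr =>
    (Real.continuousAt_rpow_const r β (Or.inl hr.1.ne')).continuousWithinAt
  exact h.smul (hf.mono Set.Ioc_subset_Icc_self)

theorem intervalIntegrable_rpow_smul {β : ℝ} (hβ : -1 < β) {f : ℝ → W}
    (hf : ContinuousOn f (Set.Icc 0 1)) :
    IntervalIntegrable (fun r : ℝ => (r ^ β) • f r) volume 0 1 := by
  refine (intervalIntegral.intervalIntegrable_rpow' hβ).smul_continuousOn ?_
  rwa [Set.uIcc_of_le zero_le_one]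

/-- The radial mean satisfies the Euler equation `(β + 1) E + z E' = g`. -/
theorem exists_hasDerivAt_radialIntegral [CompleteSpace W] {U : Set ℂ} (hU : IsOpen U)
    {g g' : ℂ → W}
    (hg : ∀ z ∈ U, HasDerivAt g (g' z) z) (hg' : ContinuousOn g' U) {β : ℝ} (hβ : -1 < β) {z : ℂ}
    (hz : ∀ r ∈ Set.Icc (0 : ℝ) 1, (r : ℂ) * z ∈ U) :
    ∃ e : W, HasDerivAt (radialIntegral β g) e z ∧
      (β + 1) • radialIntegral β g z + z • e = g z := by
  have hgc : ContinuousOn g U := fun w hw => (hg w hw).continuousAt.continuousWithinAt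
  have hKc : IsCompact ((fun r : ℝ => (r : ℂ) * z) '' Set.Icc 0 1) :=
    isCompact_Icc.image (by fun_prop)
  -- A compact thickening of the segment `[0, z]` inside `U` gives one bound on `g'` for all nearby
  -- segments, as differentiation under the integral requires.
  obtain ⟨δ, hδ, hδU⟩ := hKc.exists_cthickening_subset_open hU (by
    rintro _ ⟨r, hr, rfl⟩; exact hz r hr)
  obtain ⟨C, hC⟩ := (hKc.cthickening (r := δ)).exists_bound_of_continuousOn (hg'.mono hδU)
  have hmem : ∀ x ∈ Metric.ball z δ, ∀ r ∈ Set.Icc (0 : ℝ) 1, (r : ℂ) * x ∈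
      Metric.cthickening δ ((fun r : ℝ => (r : ℂ) * z) '' Set.Icc 0 1) := by
    intro x hx r hr
    refine Metric.mem_cthickening_of_dist_le _ ((r : ℂ) * z) _ _ ⟨r, hr, rfl⟩ ?_
    rw [dist_eq_norm, ← mul_sub, norm_mul, Complex.norm_real, Real.norm_of_nonneg hr.1]
    rw [Metric.mem_ball, dist_eq_norm] at hx
    nlinarith [hr.2, norm_nonneg (x - z)]
  have hzc := continuousOn_comp_segment hg' hz
  have hzg := continuousOn_comp_segment hgc hz
  have hu : Set.uIoc (0 : ℝ) 1 = Set.Ioc 0 1 := Set.uIoc_of_le zero_le_one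
  have hzc2 : ContinuousOn (fun r : ℝ => (r : ℂ) • g' (r * z)) (Set.Icc 0 1) :=
    ContinuousOn.smul (by fun_prop) hzc
  have key := intervalIntegral.hasDerivAt_integral_of_dominated_loc_of_deriv_le
    (μ := volume) (a := 0) (b := 1) (F := fun x r => (r ^ β) • g ((r : ℝ) * x))
    (F' := fun x r => (r ^ β) • ((r : ℂ) • g' ((r : ℝ) * x))) (bound := fun r => r ^ β * C)
    (x₀ := z) (s := Metric.ball z δ) (Metric.ball_mem_nhds z hδ)
    (by
      filter_upwards [Metric.ball_mem_nhds z hδ] with x hx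
      rw [hu]
      exact (continuousOn_rpow_smul (continuousOn_comp_segment hgc
        fun r hr => hδU (hmem x hx r hr))).aestronglyMeasurable measurableSet_Ioc)
    (intervalIntegrable_rpow_smul hβ hzg)
    (by
      rw [hu]
      exact (continuousOn_rpow_smul hzc2).aestronglyMeasurable measurableSet_Ioc)
    (by
      refine Eventually.of_forall fun r hr x hx => ?_
      rw [hu] at hr
      have h1 := hC _ (hmem x hx r ⟨hr.1.le, hr.2⟩)
      have h2 : (0 : ℝ) ≤ r ^ β := Real.rpow_nonneg hr.1.le _
      rw [norm_smul, norm_smul, Complex.norm_real, Real.norm_of_nonneg hr.1.le,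
        Real.norm_of_nonneg h2]
      refine mul_le_mul_of_nonneg_left ?_ h2
      nlinarith [hr.2, norm_nonneg (g' (r * x)), hr.1])
    ((intervalIntegral.intervalIntegrable_rpow' hβ).mul_const C)
    (by
      refine Eventually.of_forall fun r hr x hx => ?_
      rw [hu] at hr
      have h1 := hg _ (hδU (hmem x hx r ⟨hr.1.le, hr.2⟩))
      have h2 : HasDerivAt (fun x : ℂ => (r : ℂ) * x) (r : ℂ) x := by
        simpa using (hasDerivAt_id x).const_mul (r : ℂ)
      exact (h1.scomp x h2).const_smul (r ^ β))
  refine ⟨_, key.2, ?_⟩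
  have hcont : ContinuousOn (fun r : ℝ => (r ^ (β + 1)) • g (r * z)) (Set.Icc 0 1) := by
    have h : ContinuousOn (fun r : ℝ => r ^ (β + 1)) (Set.Icc 0 1) := fun r hr =>
      (Real.continuousAt_rpow_const r (β + 1) (Or.inr (by linarith))).continuousWithinAt
    exact h.smul hzg
  have hder : ∀ r ∈ Set.Ioo (0 : ℝ) 1, HasDerivAt (fun r : ℝ => (r ^ (β + 1)) • g (r * z))
      ((β + 1) • ((r ^ β) • g (r * z)) + z • ((r ^ β) • ((r : ℂ) • g' (r * z)))) r := by
    intro r hr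
    have h1 := hg _ (hz r ⟨hr.1.le, hr.2.le⟩)
    have h2 : HasDerivAt (fun r : ℝ => (r : ℂ) * z) z r := by
      simpa using (Complex.ofRealCLM.hasDerivAt (x := r)).mul_const z
    have h3 := (Real.hasDerivAt_rpow_const (x := r) (p := β + 1) (Or.inl hr.1.ne')).smul
      (h1.scomp r h2)
    refine h3.congr_deriv ?_
    simp only [Function.comp_apply]
    rw [add_sub_cancel_right, add_comm, Real.rpow_add_one hr.1.ne', mul_smul, mul_smul]
    congr 1
    rw [smul_comm z, smul_comm z, Complex.coe_smul]
  have hint : IntervalIntegrable (fun r : ℝ => (β + 1) • ((r ^ β) • g (r * z)) +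
      z • ((r ^ β) • ((r : ℂ) • g' (r * z)))) volume 0 1 :=
    ((intervalIntegrable_rpow_smul hβ hzg).smul (β + 1)).add (key.1.smul z)
  -- The Euler equation is the integral over `[0, 1]` of the derivative of `r ^ (β + 1) g (r z)`;
  -- the value at `r = 0` vanishes because `β + 1 > 0`.
  have ftc := intervalIntegral.integral_eq_sub_of_hasDerivAt_of_le zero_le_one hcont hder hint
  rw [show (∫ r in (0 : ℝ)..1, ((β + 1) • ((r ^ β) • g (r * z)) +
      z • ((r ^ β) • ((r : ℂ) • g' (r * z))))) = _ from
    intervalIntegral.integral_add ((intervalIntegrable_rpow_smul hβ hzg).smul (β + 1))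
    (key.1.smul z)] at ftc
  rw [intervalIntegral.integral_smul, intervalIntegral.integral_smul] at ftc
  rw [radialIntegral, ftc]
  simp [Real.zero_rpow (show β + 1 ≠ 0 by linarith)]

end Radial

/-! ### Contour integrals of `z ^ (-α) F z` over paths in a sector -/

section Contour

/-- The closed cone `{z : Re z ≤ c |z|}` with apex `0`. -/
def cone (c : ℝ) : Set ℂ := {z | z.re ≤ c * ‖z‖}

/-- The closed cone with apex `a`. -/
def cone' (c a : ℝ) : Set ℂ := {z | z.re - a ≤ c * ‖z - a‖}

theorem cone_mono {c c' : ℝ} (h : c ≤ c') : cone c ⊆ cone c' := fun z hz => by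
  have := mul_le_mul_of_nonneg_right h (norm_nonneg z)
  exact le_trans hz this

theorem real_mul_mem_cone {c r : ℝ} {z : ℂ} (hr : 0 ≤ r) (hz : z ∈ cone c) : (r : ℂ) * z ∈ cone c := by
  simp only [cone, Set.mem_ofPred_eq, norm_mul, Complex.norm_real, Real.norm_of_nonneg hr,
    Complex.re_ofReal_mul] at hz ⊢
  nlinarith

/-- Multiplication by `c` is 1-Lipschitz. This treats acute and obtuse sectors alike, since the sign
of `c` plays no role. -/
theorem mul_abs_sub_le {c x y d : ℝ} (hc : |c| ≤ 1) (h : |x - y| ≤ d) : c * x - d ≤ c * y := by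
  have h1 : |c * (x - y)| ≤ d := by
    rw [abs_mul]
    nlinarith [abs_nonneg (x - y), abs_nonneg c]
  have := (abs_le.1 h1).2
  linarith

/-- Moving the apex to `a` lowers `Re z` by `a` and changes the norm by at most `a`. -/
theorem cone_subset_cone' {c a : ℝ} (hc : |c| ≤ 1) (ha : 0 ≤ a) : cone c ⊆ cone' c a := by
  intro z hz
  have hz' : z.re ≤ c * ‖z‖ := hz
  have h : |‖z‖ - ‖z - a‖| ≤ a := by
    refine (abs_norm_sub_norm_le _ _).trans ?_
    simp [abs_of_nonneg ha]
  have := mul_abs_sub_le hc h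
  change z.re - a ≤ c * ‖z - a‖
  linarith

/-- The sector with apex `a ≥ 0` is star-shaped about `0`, because `r z - a = r (z - a) - (1 - r)
a`. Hence radial integrals can be formed at each of its points. -/
theorem real_mul_mem_cone' {c a r : ℝ} {z : ℂ} (hc : |c| ≤ 1) (ha : 0 ≤ a) (hr : 0 ≤ r)
    (hr1 : r ≤ 1) (hz : z ∈ cone' c a) : (r : ℂ) * z ∈ cone' c a := by
  have hz' : z.re - a ≤ c * ‖z - a‖ := hz
  have h : |r * ‖z - a‖ - ‖(r : ℂ) * z - a‖| ≤ (1 - r) * a := by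
    have h1 : r * ‖z - a‖ = ‖(r : ℂ) * (z - a)‖ := by
      rw [norm_mul, Complex.norm_real, Real.norm_of_nonneg hr]
    rw [h1]
    refine (abs_norm_sub_norm_le _ _).trans (le_of_eq ?_)
    rw [show (r : ℂ) * (z - a) - (r * z - a) = (((1 - r) * a : ℝ) : ℂ) by push_cast; ring,
      Complex.norm_real, Real.norm_of_nonneg (mul_nonneg (by linarith) ha)]
  have := mul_abs_sub_le hc h
  change ((r : ℂ) * z).re - a ≤ c * ‖(r : ℂ) * z - a‖
  rw [Complex.re_ofReal_mul]
  nlinarith [mul_le_mul_of_nonneg_left hz' hr]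

variable {W : Type*} [NormedAddCommGroup W] [NormedSpace ℂ W] [CompleteSpace W]

/-- `z ^ (β + 1) ∫₀¹ r ^ β g (r z) dr` is a primitive of `z ^ β g`. -/
theorem hasDerivAt_cpow_smul_radialIntegral {U : Set ℂ} (hU : IsOpen U)
    {g g' : ℂ → W} (hg : ∀ z ∈ U, HasDerivAt g (g' z) z) (hg' : ContinuousOn g' U)
    {β : ℝ} (hβ : -1 < β) {z : ℂ} (hz : ∀ r ∈ Set.Icc (0 : ℝ) 1, (r : ℂ) * z ∈ U)
    (hs : z ∈ Complex.slitPlane) :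
    HasDerivAt (fun z : ℂ => z ^ ((β : ℂ) + 1) • radialIntegral β g z) (z ^ (β : ℂ) • g z) z := by
  obtain ⟨e, he, hE⟩ := exists_hasDerivAt_radialIntegral hU hg hg' hβ hz
  refine (((hasDerivAt_id z).cpow_const (c := (β : ℂ) + 1) hs).smul he).congr_deriv ?_
  simp only [id, add_sub_cancel_right, mul_one]
  rw [← hE, Complex.cpow_add _ _ (Complex.slitPlane_ne_zero hs), Complex.cpow_one, smul_add,
    add_comm, ← Complex.coe_smul, smul_smul, smul_smul]
  push_cast
  ring_nf

/-- The coefficients `(-1) ^ k / ((1 - α) ⋯ (k - α))` from repeated integration by parts. -/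
def partsCoeff (α : ℝ) (k : ℕ) : ℝ := (-1) ^ k / ∏ j ∈ Finset.Icc 1 k, ((j : ℝ) - α)

theorem partsCoeff_zero (α : ℝ) : partsCoeff α 0 = 1 := by simp [partsCoeff]

theorem partsCoeff_succ (α : ℝ) (k : ℕ) :
    partsCoeff α (k + 1) = -(partsCoeff α k / ((k : ℝ) + 1 - α)) := by
  rw [partsCoeff, partsCoeff, Finset.prod_Icc_succ_top (by omega), pow_succ, div_div]
  push_cast
  ring

/-- A primitive of `z ^ (-α) D 0 z` when `D (k + 1)` is the derivative of `D k`. -/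
def fracPrimitive (D : ℕ → ℂ → W) (α : ℝ) (n : ℕ) (z : ℂ) : W :=
  ∑ k ∈ Finset.range n,
      (partsCoeff α k / ((k : ℝ) + 1 - α)) • (z ^ ((k : ℂ) + 1 - α) • D k z) +
    partsCoeff α n • (z ^ ((((n : ℝ) - α : ℝ) : ℂ) + 1) • radialIntegral ((n : ℝ) - α) (D n) z)

/-- The derivative of the `k`-th boundary term is a difference of consecutive terms `partsCoeff α k
• z ^ (k - α) • D k z`, so the sum telescopes, and the radial term supplies the missing one with `k
= n`. Non-integrality of `α` keeps the denominators `k + 1 - α` nonzero. -/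
theorem hasDerivAt_fracPrimitive {U : Set ℂ} (hU : IsOpen U) {D : ℕ → ℂ → W}
    (hD : ∀ k, ∀ z ∈ U, HasDerivAt (D k) (D (k + 1) z) z) {α : ℝ} {n : ℕ}
    (hα : α < n + 1) (hα' : ∀ m : ℕ, α ≠ m) {z : ℂ}
    (hz : ∀ r ∈ Set.Icc (0 : ℝ) 1, (r : ℂ) * z ∈ U) (hs : z ∈ Complex.slitPlane) :
    HasDerivAt (fracPrimitive D α n) (z ^ (-α : ℂ) • D 0 z) z := by
  have hzU : z ∈ U := by simpa using hz 1 (by simp)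
  have hcont : ContinuousOn (D (n + 1)) U := fun w hw =>
    (hD (n + 1) w hw).continuousAt.continuousWithinAt
  have h1 := (hasDerivAt_cpow_smul_radialIntegral hU (hD n) hcont (β := (n : ℝ) - α)
    (by linarith) hz hs).const_smul (partsCoeff α n)
  have h2 : ∀ k ∈ Finset.range n, HasDerivAt
      (fun z : ℂ => (partsCoeff α k / ((k : ℝ) + 1 - α)) • (z ^ ((k : ℂ) + 1 - α) • D k z))
      (partsCoeff α k • (z ^ ((k : ℂ) - α) • D k z) -
        partsCoeff α (k + 1) • (z ^ (((k + 1 : ℕ) : ℂ) - α) • D (k + 1) z)) z := by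
    intro k _
    have hk : (k : ℝ) + 1 - α ≠ 0 := by
      have := hα' (k + 1)
      push_cast at this
      intro h; apply this; linarith
    refine ((((hasDerivAt_id z).cpow_const (c := (k : ℂ) + 1 - α) hs).smul
      (hD k z hzU)).const_smul (partsCoeff α k / ((k : ℝ) + 1 - α))).congr_deriv ?_
    simp only [id, mul_one]
    rw [partsCoeff_succ, smul_add, add_comm, neg_smul, sub_neg_eq_add]
    push_cast
    congr 1
    rw [show (k : ℂ) + 1 - α - 1 = k - α by ring, mul_smul,
      show ((k : ℂ) + 1 - α) = (((k : ℝ) + 1 - α : ℝ) : ℂ) by push_cast; ring, Complex.coe_smul,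
      smul_smul, div_mul_cancel₀ _ hk]
  have h3 := (HasDerivAt.fun_sum h2).add h1
  refine h3.congr_deriv ?_
  rw [Finset.sum_range_sub' (fun k : ℕ => partsCoeff α k • (z ^ ((k : ℂ) - α) • D k z))]
  push_cast
  simp [partsCoeff_zero]

end Contour

/-! ### Cauchy estimates, and the radial primitive compared with the cut -/

section Contour

variable {W : Type*} [NormedAddCommGroup W] [NormedSpace ℂ W] [CompleteSpace W]

/-- Cauchy estimates on a smaller cone. -/
theorem exists_norm_iteratedDeriv_le {F : ℂ → W} {c c₁ M : ℝ} (hc : |c| ≤ 1) (hc₁ : c₁ < c)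
    (hc₁' : -1 < c₁)
    {U : Set ℂ} (hF : DifferentiableOn ℂ F U) (hcU : cone c ⊆ U)
    (hM : ∀ z ∈ cone c, ‖F z‖ ≤ M / (1 + ‖z‖)) (k : ℕ) :
    ∃ C : ℝ, 0 ≤ C ∧ ∀ z ∈ cone c₁, z ≠ 0 → ‖iteratedDeriv k F z‖ ≤ C / ‖z‖ ^ (k + 1) := by
  -- With this `δ`, the disc of radius `δ |z|` about a point of the smaller cone stays in the larger
  -- one: both `Re w` and `c |w|` move by at most `δ |z|`, against a gap of `4 δ |z|`. As `δ ≤ 1/2`,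
  -- also `|w| ≥ |z| / 2` on its boundary, which gives the bound `2 M / |z|` there.
  set δ : ℝ := (c - c₁) / 4 with hδ
  have hδ0 : 0 < δ := by rw [hδ]; linarith
  have hδ1 : δ ≤ 1 / 2 := by rw [hδ]; linarith [(abs_le.1 hc).2]
  have hM0 : 0 ≤ M := by
    have := (norm_nonneg _).trans (hM 0 (by simp [cone]))
    simpa using this
  refine ⟨k.factorial * (2 * M) / δ ^ k, by positivity, fun z hz hz0 => ?_⟩
  have hzn : 0 < ‖z‖ := norm_pos_iff.2 hz0
  have hz' : z.re ≤ c₁ * ‖z‖ := hz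
  have hball : Metric.closedBall z (δ * ‖z‖) ⊆ cone c := by
    intro w hw
    rw [mem_closedBall_iff_norm] at hw
    have h1 : |‖z‖ - ‖w‖| ≤ δ * ‖z‖ := (abs_norm_sub_norm_le _ _).trans (by rwa [norm_sub_rev])
    have h2 := mul_abs_sub_le hc h1
    have h3 : w.re - z.re ≤ δ * ‖z‖ := by
      rw [← Complex.sub_re]; exact (Complex.re_le_norm _).trans hw
    change w.re ≤ c * ‖w‖
    have h4 : c₁ * ‖z‖ + 4 * (δ * ‖z‖) = c * ‖z‖ := by rw [hδ]; ring
    nlinarith [mul_pos hδ0 hzn]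
  have hR : 0 < δ * ‖z‖ := by positivity
  have hd : DiffContOnCl ℂ F (Metric.ball z (δ * ‖z‖)) :=
    (hF.mono (hball.trans hcU)).diffContOnCl_ball subset_rfl
  refine (Complex.norm_iteratedDeriv_le_of_forall_mem_sphere_norm_le (C := 2 * M / ‖z‖)
    k hR hd ?_).trans (le_of_eq ?_)
  · intro w hw
    refine (hM w (hball (Metric.sphere_subset_closedBall hw))).trans ?_
    rw [mem_sphere_iff_norm] at hw
    have h1 : ‖z‖ - ‖w‖ ≤ δ * ‖z‖ := (norm_sub_norm_le _ _).trans (by rw [norm_sub_rev, hw])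
    rw [div_le_div_iff₀ (by positivity) hzn]
    have h2 : ‖z‖ ≤ 2 * (1 + ‖w‖) := by nlinarith
    nlinarith [norm_nonneg w]
  · rw [mul_pow, pow_succ]
    field_simp

theorem hasDerivAt_iteratedDeriv {F : ℂ → W} {U : Set ℂ} (hU : IsOpen U)
    (hF : DifferentiableOn ℂ F U) (k : ℕ) {z : ℂ} (hz : z ∈ U) :
    HasDerivAt (iteratedDeriv k F) (iteratedDeriv (k + 1) F z) z := by
  have h : AnalyticAt ℂ F z := hF.analyticAt (hU.mem_nhds hz)
  have : AnalyticAt ℂ (iteratedDeriv k F) z := by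
    rw [iteratedDeriv_eq_iterate]
    exact h.iterated_deriv k
  rw [iteratedDeriv_succ]
  exact this.differentiableAt.hasDerivAt

theorem cpow_ofReal_eq {z : ℂ} (hz : z ≠ 0) (p : ℝ) :
    z ^ (p : ℂ) = ((‖z‖ ^ p : ℝ) : ℂ) * Complex.exp (z.arg * p * Complex.I) := by
  rw [Complex.cpow_def_of_ne_zero hz, Complex.log, Real.rpow_def_of_pos (norm_pos_iff.2 hz),
    Complex.ofReal_exp, ← Complex.exp_add]
  push_cast
  ring_nf

theorem norm_cpow_ofReal {z : ℂ} (hz : z ≠ 0) (p : ℝ) : ‖z ^ (p : ℂ)‖ = ‖z‖ ^ p := by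
  rw [cpow_ofReal_eq hz, norm_mul, Complex.norm_real,
    Real.norm_of_nonneg (Real.rpow_nonneg (norm_nonneg _) _)]
  rw [show (z.arg : ℂ) * p * Complex.I = ((z.arg * p : ℝ) : ℂ) * Complex.I by push_cast; ring,
    Complex.norm_exp_ofReal_mul_I, mul_one]

/-- The substitution `ρ = R r`: on the cut, the radial primitive is a truncation of the integral in
the final formula, up to the phase. -/
theorem radialIntegral_neg_real (g : ℂ → W) {β R : ℝ} (hR : 0 < R) :
    (R ^ (β + 1)) • radialIntegral β g (-R) = ∫ ρ in (0 : ℝ)..R, (ρ ^ β) • g (-ρ) := by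
  have h := intervalIntegral.integral_comp_mul_left (a := 0) (b := 1)
    (fun ρ : ℝ => (ρ ^ β) • g (-ρ)) hR.ne'
  rw [mul_zero, mul_one] at h
  rw [eq_inv_smul_iff₀ hR.ne'] at h
  rw [← h, radialIntegral, Real.rpow_add_one hR.ne', mul_comm, mul_smul,
    ← intervalIntegral.integral_smul]
  congr 1
  refine intervalIntegral.integral_congr fun r hr => ?_
  rw [Set.uIcc_of_le zero_le_one] at hr
  rw [smul_smul, Real.mul_rpow hR.le hr.1]
  push_cast
  rw [mul_neg, mul_comm (r : ℂ)]

/-- Comparison of the radial primitive at a point of a cone with its value on the cut. -/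
theorem norm_cpow_smul_radialIntegral_sub_le {U : Set ℂ} (hU : IsOpen U)
    {g g' : ℂ → W} (hg : ∀ z ∈ U, HasDerivAt g (g' z) z) (hg' : ContinuousOn g' U)
    {β : ℝ} (hβ : -1 < β) {c C : ℝ} (hcU : cone c ⊆ U) {n : ℕ} (hC0 : 0 ≤ C)
    (hC : ∀ z ∈ cone c, z ≠ 0 → ‖g z‖ ≤ C / ‖z‖ ^ (n + 1))
    {σ : ℝ} (hσ : σ = 1 ∨ σ = -1) {z : ℂ} (hz : z ∈ cone c) (him : 0 < σ * z.im) :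
    ‖z ^ ((β : ℂ) + 1) • radialIntegral β g z -
      Complex.exp (σ * Real.pi * (β + 1) * Complex.I) • ∫ ρ in (0 : ℝ)..‖z‖, (ρ ^ β) • g (-ρ)‖ ≤
      C * Real.pi * ‖z‖ ^ (β - n) := by
  have hz0 : z ≠ 0 := by rintro rfl; simp at him
  set R : ℝ := ‖z‖ with hRdef
  have hR : 0 < R := norm_pos_iff.2 hz0
  -- The sign `σ` records the side of the cut, so both sides are handled by angles `ψ` increasing
  -- from `ψ₀` to `π`.
  set ψ₀ : ℝ := |z.arg| with hψ₀
  have harg : z.arg = σ * ψ₀ := by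
    rcases hσ with rfl | rfl
    · have : 0 ≤ z.arg := Complex.arg_nonneg_iff.2 (by linarith)
      rw [hψ₀, abs_of_nonneg this, one_mul]
    · have : z.arg < 0 := Complex.arg_neg_iff.2 (by linarith)
      rw [hψ₀, abs_of_neg this]; ring
  have hcosσ : ∀ ψ : ℝ, Real.cos (σ * ψ) = Real.cos ψ := by
    intro ψ; rcases hσ with rfl | rfl <;> simp
  have hσ2 : |σ| = 1 := by rcases hσ with rfl | rfl <;> simp
  have hzpol : z = R * Complex.exp (σ * ψ₀ * Complex.I) := by
    conv_lhs => rw [← Complex.norm_mul_exp_arg_mul_I z]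
    rw [harg]; push_cast; rfl
  have hψ₀0 : 0 ≤ ψ₀ := abs_nonneg _
  have hψ₀π : ψ₀ ≤ Real.pi := Complex.abs_arg_le_pi z
  set w : ℝ → ℂ := fun ψ => R * Complex.exp (σ * ψ * Complex.I) with hw
  have hwnorm : ∀ ψ, ‖w ψ‖ = R := by
    intro ψ
    simp only [hw]
    rw [norm_mul, Complex.norm_real, Real.norm_of_nonneg hR.le,
      show (σ : ℂ) * ψ * Complex.I = ((σ * ψ : ℝ) : ℂ) * Complex.I by push_cast; ring,
      Complex.norm_exp_ofReal_mul_I, mul_one]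
  have hwre : ∀ ψ, (w ψ).re = R * Real.cos ψ := by
    intro ψ
    simp only [hw]
    rw [show (σ : ℂ) * ψ * Complex.I = ((σ * ψ : ℝ) : ℂ) * Complex.I by push_cast; ring,
      Complex.re_ofReal_mul, Complex.exp_ofReal_mul_I_re, hcosσ]
  have hwcone : ∀ ψ ∈ Set.Icc ψ₀ Real.pi, w ψ ∈ cone c := by
    intro ψ hψ
    change (w ψ).re ≤ c * ‖w ψ‖
    have h1 : z.re ≤ c * R := hz
    have h2 : z.re = R * Real.cos ψ₀ := by rw [← hwre]; exact congrArg _ hzpol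
    have h3 := Real.cos_le_cos_of_nonneg_of_le_pi hψ₀0 hψ.2 hψ.1
    rw [hwre, hwnorm]
    nlinarith
  have hwne : ∀ ψ, w ψ ≠ 0 := fun ψ => norm_pos_iff.1 (by rw [hwnorm]; exact hR)
  -- By the Euler equation, the derivative of `f` along the arc is `iσ e^{iσψ(β+1)} g(w ψ)`, with no
  -- radial integral left. The mean value inequality on an arc of angle at most `π` then gives the
  -- error.
  set f : ℝ → W := fun ψ =>
    (Complex.exp (σ * ψ * (β + 1) * Complex.I)) • radialIntegral β g (w ψ) with hf
  have hder : ∀ ψ ∈ Set.Icc ψ₀ Real.pi, HasDerivAt f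
      ((σ * Complex.I * Complex.exp (σ * ψ * (β + 1) * Complex.I)) • g (w ψ)) ψ := by
    intro ψ hψ
    obtain ⟨e, he, hE⟩ := exists_hasDerivAt_radialIntegral hU hg hg' hβ (z := w ψ)
      fun r hr => hcU (real_mul_mem_cone hr.1 (hwcone ψ hψ))
    have h0 : ∀ b : ℂ, HasDerivAt (fun ψ : ℝ => Complex.exp (σ * ψ * b * Complex.I))
        (Complex.exp (σ * ψ * b * Complex.I) * (σ * b * Complex.I)) ψ := by
      intro b
      have : HasDerivAt (fun ψ : ℝ => (σ : ℂ) * ψ * b * Complex.I) (σ * b * Complex.I) ψ := by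
        simpa using (((Complex.ofRealCLM.hasDerivAt (x := ψ)).const_mul (σ : ℂ)).mul_const
          b).mul_const Complex.I
      exact this.cexp
    have h1 : HasDerivAt w (σ * Complex.I * w ψ) ψ := by
      have := (h0 1).const_mul (R : ℂ)
      simp only [mul_one] at this
      refine this.congr_deriv ?_
      simp only [hw]; ring
    refine ((h0 (β + 1)).smul (he.scomp ψ h1)).congr_deriv ?_
    rw [← hE, ← Complex.coe_smul]
    simp only [smul_add, smul_smul, Function.comp_apply]
    push_cast
    rw [add_comm]
    ring_nf
  have hbound : ∀ ψ ∈ Set.Icc ψ₀ Real.pi,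
      ‖(σ * Complex.I * Complex.exp (σ * ψ * (β + 1) * Complex.I)) • g (w ψ)‖ ≤ C / R ^ (n + 1) := by
    intro ψ hψ
    rw [norm_smul, norm_mul, norm_mul, Complex.norm_real, Real.norm_eq_abs, hσ2, Complex.norm_I,
      show (σ : ℂ) * ψ * (β + 1) * Complex.I = ((σ * ψ * (β + 1) : ℝ) : ℂ) * Complex.I by
        push_cast; ring, Complex.norm_exp_ofReal_mul_I, one_mul, one_mul, one_mul]
    have := hC _ (hwcone ψ hψ) (hwne ψ)
    rwa [hwnorm] at this
  have hmv := norm_image_sub_le_of_norm_deriv_le_segment' (a := ψ₀) (b := Real.pi)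
    (fun ψ hψ => (hder ψ hψ).hasDerivWithinAt)
    (fun ψ hψ => hbound ψ ⟨hψ.1, hψ.2.le⟩) Real.pi ⟨hψ₀π, le_rfl⟩
  have hwπ : w Real.pi = -R := by
    simp only [hw]
    rcases hσ with rfl | rfl
    · simp [Complex.exp_pi_mul_I]
    · simp [Complex.exp_neg, Complex.exp_pi_mul_I]
  have h1 : z ^ ((β : ℂ) + 1) • radialIntegral β g z = (R ^ (β + 1)) • f ψ₀ := by
    simp only [hf]
    rw [show w ψ₀ = z from hzpol.symm, ← Complex.coe_smul, smul_smul,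
      show (β : ℂ) + 1 = ((β + 1 : ℝ) : ℂ) by push_cast; ring, cpow_ofReal_eq hz0, harg]
    push_cast
    rfl
  have h2 : Complex.exp (σ * Real.pi * (β + 1) * Complex.I) •
      (∫ ρ in (0 : ℝ)..R, (ρ ^ β) • g (-ρ)) = (R ^ (β + 1)) • f Real.pi := by
    simp only [hf]
    rw [← radialIntegral_neg_real g hR, hwπ, smul_comm]
  rw [h1, h2, ← smul_sub, norm_smul, norm_sub_rev,
    Real.norm_of_nonneg (Real.rpow_nonneg hR.le _)]
  have h3 : ‖f Real.pi - f ψ₀‖ ≤ C / R ^ (n + 1) * Real.pi := by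
    refine hmv.trans (mul_le_mul_of_nonneg_left (by linarith) (by positivity))
  refine (mul_le_mul_of_nonneg_left h3 (Real.rpow_nonneg hR.le _)).trans (le_of_eq ?_)
  rw [show β - n = (β + 1) - (n + 1 : ℕ) by push_cast; ring, Real.rpow_sub hR, Real.rpow_natCast]
  ring

end Contour

/-! ### Piecewise `C¹` paths: continuity and integrability of the derivative -/

section Piecewise

variable {E : Type*} [NormedAddCommGroup E] [NormedSpace ℝ E]

theorem exists_pos_forall_notMem_Ioo (P : Finset ℝ) (t : ℝ) :
    ∃ ε > 0, ∀ s ∈ P, |s - t| < ε → s = t := by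
  have h : ((P.erase t : Finset ℝ) : Set ℝ)ᶜ ∈ 𝓝 t :=
    (P.erase t).finite_toSet.isClosed.isOpen_compl.mem_nhds (by simp)
  obtain ⟨ε, hε, hb⟩ := Metric.mem_nhds_iff.1 h
  refine ⟨ε, hε, fun s hs hst => ?_⟩
  by_contra hne
  exact hb (show s ∈ Metric.ball t ε by rwa [Metric.mem_ball, Real.dist_eq]) (by simp [hs, hne])

variable {Γ : ℝ → E} {P : Finset ℝ}
  (hP : ∀ a b : ℝ, a < b → (∀ t ∈ P, t ∉ Set.Ioo a b) → ContDiffOn ℝ 1 Γ (Set.Icc a b))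

include hP

theorem differentiableAt_of_piecewise {t : ℝ} (ht : t ∉ P) : DifferentiableAt ℝ Γ t := by
  obtain ⟨ε, hε, h⟩ := exists_pos_forall_notMem_Ioo P t
  have := hP (t - ε) (t + ε) (by linarith) fun s hs hst => ht (by
    rw [← h s hs (abs_lt.2 ⟨by linarith [hst.1], by linarith [hst.2]⟩)]; exact hs)
  exact (this.contDiffAt (Icc_mem_nhds (by linarith) (by linarith))).differentiableAt (by simp)

/-- Break points other than `t` stay at positive distance from `t`, so `t` is an endpoint of a
smooth interval on either side, even when it is itself a break point. -/
theorem exists_contDiffOn_of_piecewise (t : ℝ) :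
    ∃ ε > 0, ContDiffOn ℝ 1 Γ (Set.Icc (t - ε) t) ∧ ContDiffOn ℝ 1 Γ (Set.Icc t (t + ε)) := by
  obtain ⟨ε, hε, h⟩ := exists_pos_forall_notMem_Ioo P t
  refine ⟨ε, hε, hP _ _ (by linarith) fun s hs hst => ?_, hP _ _ (by linarith) fun s hs hst => ?_⟩
  · have := h s hs (abs_lt.2 ⟨by linarith [hst.1], by linarith [hst.2]⟩)
    linarith [hst.2]
  · have := h s hs (abs_lt.2 ⟨by linarith [hst.1], by linarith [hst.2]⟩)
    linarith [hst.1]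

theorem continuous_of_piecewise : Continuous Γ := by
  refine continuous_iff_continuousAt.2 fun t => ?_
  obtain ⟨ε, hε, h1, h2⟩ := exists_contDiffOn_of_piecewise hP t
  rw [continuousAt_iff_continuous_left_right]
  constructor
  · exact (h1.continuousOn t ⟨by linarith, le_rfl⟩).mono_of_mem_nhdsWithin
      (Icc_mem_nhdsLE (by linarith))
  · exact (h2.continuousOn t ⟨le_rfl, by linarith⟩).mono_of_mem_nhdsWithin
      (Icc_mem_nhdsGE (by linarith))

omit hP in
theorem integrableOn_deriv_of_contDiffOn {a b : ℝ} (hab : a < b)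
    (h : ContDiffOn ℝ 1 Γ (Set.Icc a b)) : IntegrableOn (deriv Γ) (Set.Icc a b) := by
  have h1 : IntegrableOn (derivWithin Γ (Set.Icc a b)) (Set.Ioo a b) :=
    ((h.continuousOn_derivWithin (uniqueDiffOn_Icc hab) le_rfl).integrableOn_Icc).mono_set
      Set.Ioo_subset_Icc_self
  rw [integrableOn_Icc_iff_integrableOn_Ioo]
  refine h1.congr_fun (fun t ht => ?_) measurableSet_Ioo
  exact derivWithin_of_mem_nhds (Icc_mem_nhds ht.1 ht.2)

theorem intervalIntegrable_deriv_of_piecewise (a b : ℝ) :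
    IntervalIntegrable (deriv Γ) volume a b := by
  have : LocallyIntegrable (deriv Γ) volume := by
    intro t
    obtain ⟨ε, hε, h1, h2⟩ := exists_contDiffOn_of_piecewise hP t
    refine ⟨_, ?_, (integrableOn_deriv_of_contDiffOn (by linarith) h1).union
      (integrableOn_deriv_of_contDiffOn (by linarith) h2)⟩
    rw [Set.Icc_union_Icc_eq_Icc (by linarith) (by linarith)]
    exact Icc_mem_nhds (by linarith) (by linarith)
  exact (this.integrableOn_isCompact isCompact_uIcc).intervalIntegrable

end Piecewise

/-! ### The primitive at infinity and the value of the contour integral -/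

section Contour

variable {W : Type*} [NormedAddCommGroup W] [NormedSpace ℂ W] [CompleteSpace W]

theorem tendsto_cpow_smul_of_norm_le {ι : Type*} {l : Filter ι} {ζ : ι → ℂ} {α : ℝ} (hα : 0 < α)
    (hζ : Tendsto (fun i => ‖ζ i‖) l atTop) {c C : ℝ} (hc : ∀ᶠ i in l, ζ i ∈ cone c)
    {g : ℂ → W} {k : ℕ} (hC : ∀ z ∈ cone c, z ≠ 0 → ‖g z‖ ≤ C / ‖z‖ ^ (k + 1)) :
    Tendsto (fun i => (ζ i) ^ ((k : ℂ) + 1 - α) • g (ζ i)) l (𝓝 0) := by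
  have h1 : Tendsto (fun i => C * ‖ζ i‖ ^ (-α)) l (𝓝 0) := by
    simpa using ((tendsto_rpow_neg_atTop hα).comp hζ).const_mul C
  refine squeeze_zero_norm' ?_ h1
  filter_upwards [hc, hζ.eventually_gt_atTop 0] with i hi hi0
  have hne : ζ i ≠ 0 := norm_pos_iff.1 hi0
  rw [norm_smul, show (k : ℂ) + 1 - α = ((((k + 1 : ℕ) : ℝ) - α : ℝ) : ℂ) by push_cast; ring,
    norm_cpow_ofReal hne]
  refine (mul_le_mul_of_nonneg_left (hC _ hi hne) (Real.rpow_nonneg hi0.le _)).trans (le_of_eq ?_)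
  rw [Real.rpow_sub hi0, Real.rpow_neg hi0.le, Real.rpow_natCast]
  field_simp

/-- The boundary terms are `O(|ζ|^{-α})`, and so is the difference between the radial term and its
value on the cut. The latter converges by integrability on the half line; only the phase depends on
the side `σ` of approach. -/
theorem tendsto_fracPrimitive {ι : Type*} {l : Filter ι} [l.IsCountablyGenerated] {ζ : ι → ℂ} {U : Set ℂ} (hU : IsOpen U)
    {D : ℕ → ℂ → W} (hD : ∀ k, ∀ z ∈ U, HasDerivAt (D k) (D (k + 1) z) z) {α : ℝ} {n : ℕ}
    (hα0 : 0 < α) (hα : α < n + 1) {c : ℝ} (hcU : cone c ⊆ U)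
    (hC : ∀ k, ∃ C : ℝ, 0 ≤ C ∧ ∀ z ∈ cone c, z ≠ 0 → ‖D k z‖ ≤ C / ‖z‖ ^ (k + 1))
    (hint : IntegrableOn (fun ρ : ℝ => (ρ ^ ((n : ℝ) - α)) • D n (-ρ)) (Set.Ioi 0))
    {σ : ℝ} (hσ : σ = 1 ∨ σ = -1) (hζ : Tendsto (fun i => ‖ζ i‖) l atTop)
    (hc : ∀ᶠ i in l, ζ i ∈ cone c) (him : ∀ᶠ i in l, 0 < σ * (ζ i).im) :
    Tendsto (fun i => fracPrimitive D α n (ζ i)) l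
      (𝓝 (partsCoeff α n • (Complex.exp (σ * Real.pi * (((n : ℝ) - α : ℝ) + 1) * Complex.I) •
        ∫ ρ in Set.Ioi (0 : ℝ), (ρ ^ ((n : ℝ) - α)) • D n (-ρ)))) := by
  have hcont : ContinuousOn (D (n + 1)) U := fun w hw =>
    (hD (n + 1) w hw).continuousAt.continuousWithinAt
  obtain ⟨C, hC0, hCn⟩ := hC n
  have h1 : Tendsto (fun i => ∑ k ∈ Finset.range n,
      (partsCoeff α k / ((k : ℝ) + 1 - α)) • ((ζ i) ^ ((k : ℂ) + 1 - α) • D k (ζ i))) l (𝓝 0) := by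
    rw [← Finset.sum_const_zero (s := Finset.range n)]
    refine tendsto_finsetSum _ fun k _ => ?_
    obtain ⟨C, -, hCk⟩ := hC k
    simpa using (tendsto_cpow_smul_of_norm_le hα0 hζ hc hCk).const_smul
      (partsCoeff α k / ((k : ℝ) + 1 - α))
  have h2 := (intervalIntegral_tendsto_integral_Ioi 0 hint hζ).const_smul
    (Complex.exp (σ * Real.pi * (((n : ℝ) - α : ℝ) + 1) * Complex.I))
  have h3 : Tendsto (fun i => C * Real.pi * ‖ζ i‖ ^ (-α)) l (𝓝 0) := by
    simpa using ((tendsto_rpow_neg_atTop hα0).comp hζ).const_mul (C * Real.pi)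
  have h4 : Tendsto (fun i =>
      (ζ i) ^ ((((n : ℝ) - α : ℝ) : ℂ) + 1) • radialIntegral ((n : ℝ) - α) (D n) (ζ i) -
      Complex.exp (σ * Real.pi * (((n : ℝ) - α : ℝ) + 1) * Complex.I) •
        ∫ ρ in (0 : ℝ)..‖ζ i‖, (ρ ^ ((n : ℝ) - α)) • D n (-ρ)) l (𝓝 0) := by
    refine squeeze_zero_norm' ?_ h3
    filter_upwards [hc, him] with i hi hi'
    have := norm_cpow_smul_radialIntegral_sub_le hU (hD n) hcont (β := (n : ℝ) - α)
      (by linarith) hcU hC0 hCn hσ hi hi'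
    rwa [show (n : ℝ) - α - n = -α by ring] at this
  have h5 := h1.add ((h4.add h2).const_smul (partsCoeff α n))
  simp only [zero_add, sub_add_cancel] at h5
  exact h5

/-- The improper contour integral of `z ^ (-α) F z` in terms of the values of the `n`-th
derivative of `F` on the negative half line. -/
theorem tendsto_contourIntegral {U : Set ℂ} (hU : IsOpen U) {F : ℂ → W}
    (hF : DifferentiableOn ℂ F U) {α : ℝ} {n : ℕ} (hα0 : 0 < α) (hα : α < n + 1)
    (hα' : ∀ m : ℕ, α ≠ m) {c a M : ℝ} (hc1 : -1 < c) (hc2 : c < 1) (ha : 0 < a)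
    (hcU : cone' c a ⊆ U) (hM : ∀ z ∈ cone' c a, ‖F z‖ ≤ M / (1 + ‖z‖))
    (hint : IntegrableOn (fun ρ : ℝ => (ρ ^ ((n : ℝ) - α)) • iteratedDeriv n F (-ρ)) (Set.Ioi 0))
    {γ : ℝ → ℂ} {P : Finset ℝ}
    (hP : ∀ a b : ℝ, a < b → (∀ t ∈ P, t ∉ Set.Ioo a b) → ContDiffOn ℝ 1 γ (Set.Icc a b))
    (hγ : ∀ t, γ t ∈ cone' c a) (hγs : ∀ t, γ t ∈ Complex.slitPlane) {u : ℂ} (hu : u.re < c)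
    (hu' : 0 < u.im)
    (hbot : Tendsto (fun t => ‖γ t‖) atBot atTop)
    (hbot' : Tendsto (fun t => ‖γ t‖⁻¹ • γ t) atBot (𝓝 u))
    (htop : Tendsto (fun t => ‖γ t‖) atTop atTop)
    (htop' : Tendsto (fun t => ‖γ t‖⁻¹ • γ t) atTop (𝓝 (starRingEnd ℂ u))) :
    Tendsto (fun p : ℝ × ℝ => ∫ t in p.1..p.2,
        (γ t ^ (-α : ℂ) * (-Complex.I * deriv γ t)) • F (γ t)) (atBot ×ˢ atTop)
      (𝓝 ((2 * partsCoeff α n * (-1) ^ (n + 1) * Real.sin (α * Real.pi)) •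
        ∫ ρ in Set.Ioi (0 : ℝ), (ρ ^ ((n : ℝ) - α)) • iteratedDeriv n F (-ρ))) := by
  have hc : |c| ≤ 1 := abs_le.2 ⟨hc1.le, hc2.le⟩
  have hcc : cone c ⊆ cone' c a := cone_subset_cone' hc ha.le
  set D : ℕ → ℂ → W := fun k => iteratedDeriv k F with hDdef
  have hD : ∀ k, ∀ z ∈ U, HasDerivAt (D k) (D (k + 1) z) z := fun k z hz =>
    hasDerivAt_iteratedDeriv hU hF k hz
  -- The ends of the path lie in a strictly smaller cone, since `Re u < c`; the Cauchy estimates are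
  -- available there.
  obtain ⟨c₁, hc₁, hc₁', huc⟩ : ∃ c₁, c₁ < c ∧ -1 < c₁ ∧ u.re < c₁ := by
    refine ⟨max ((u.re + c) / 2) ((c - 1) / 2), max_lt (by linarith) (by linarith),
      lt_max_of_lt_right (by linarith), lt_max_of_lt_left (by linarith)⟩
  have hcone : ∀ {l : Filter ℝ} {v : ℂ}, v.re < c₁ → Tendsto (fun t => ‖γ t‖) l atTop →
      Tendsto (fun t => ‖γ t‖⁻¹ • γ t) l (𝓝 v) → ∀ᶠ t in l, γ t ∈ cone c₁ := by
    intro l v hv h1 h2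
    have h3 := ((Complex.continuous_re.tendsto v).comp h2).eventually_lt_const hv
    filter_upwards [h1.eventually_gt_atTop 0, h3] with t ht ht'
    simp only [Function.comp_apply, Complex.real_smul, Complex.re_ofReal_mul] at ht'
    rw [inv_mul_eq_div, div_lt_iff₀ ht] at ht'
    exact ht'.le
  have himag : ∀ {l : Filter ℝ} {v : ℂ} {σ : ℝ}, 0 < σ * v.im → Tendsto (fun t => ‖γ t‖) l atTop →
      Tendsto (fun t => ‖γ t‖⁻¹ • γ t) l (𝓝 v) → ∀ᶠ t in l, 0 < σ * (γ t).im := by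
    intro l v σ hv h1 h2
    have h3 := (((Complex.continuous_im.tendsto v).comp h2).const_mul σ).eventually_const_lt hv
    filter_upwards [h1.eventually_gt_atTop 0, h3] with t ht ht'
    simp only [Function.comp_apply, Complex.real_smul, Complex.im_ofReal_mul] at ht'
    rw [mul_left_comm] at ht'
    exact pos_of_mul_pos_right ht' (by positivity)
  have hC : ∀ k, ∃ C : ℝ, 0 ≤ C ∧ ∀ z ∈ cone c₁, z ≠ 0 → ‖D k z‖ ≤ C / ‖z‖ ^ (k + 1) := fun k =>
    exists_norm_iteratedDeriv_le hc hc₁ hc₁' hF (hcc.trans hcU) (fun z hz => hM z (hcc hz)) k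
  have hc₁U : cone c₁ ⊆ U := (cone_mono hc₁.le).trans (hcc.trans hcU)
  have hlim1 := tendsto_fracPrimitive hU hD hα0 hα hc₁U hC hint (Or.inl rfl) hbot
    (hcone huc hbot hbot') (himag (by simpa using hu') hbot hbot')
  have hlim2 := tendsto_fracPrimitive hU hD hα0 hα hc₁U hC hint (Or.inr rfl) htop
    (hcone (by simpa using huc) htop htop') (himag (by simpa using hu') htop htop')
  have hcontγ : Continuous γ := continuous_of_piecewise hP
  have hseg : ∀ t, ∀ r ∈ Set.Icc (0 : ℝ) 1, (r : ℂ) * γ t ∈ U := fun t r hr =>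
    hcU (real_mul_mem_cone' hc ha.le hr.1 hr.2 (hγ t))
  have hprim : ∀ t, HasDerivAt (fracPrimitive D α n) (γ t ^ (-α : ℂ) • D 0 (γ t)) (γ t) :=
    fun t => hasDerivAt_fracPrimitive hU hD hα hα' (hseg t) (hγs t)
  have hD0 : D 0 = F := by simp [hDdef]
  have hFc : Continuous fun t => γ t ^ (-α : ℂ) • F (γ t) := by
    refine continuous_iff_continuousAt.2 fun t => ContinuousAt.smul ?_ ?_
    · exact (continuousAt_id.cpow continuousAt_const (hγs t)).comp hcontγ.continuousAt
    · exact ((hF.differentiableAt (hU.mem_nhds (hcU (hγ t)))).continuousAt).comp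
        hcontγ.continuousAt
  have hftc : ∀ p : ℝ × ℝ, (∫ t in p.1..p.2,
      (γ t ^ (-α : ℂ) * (-Complex.I * deriv γ t)) • F (γ t)) =
      (-Complex.I) • (fracPrimitive D α n (γ p.2) - fracPrimitive D α n (γ p.1)) := by
    intro p
    rw [← MeasureTheory.integral_eq_of_hasDerivAt_off_countable
      (fun t => fracPrimitive D α n (γ t)) (fun t => deriv γ t • (γ t ^ (-α : ℂ) • F (γ t)))
      P.countable_toSet, ← intervalIntegral.integral_smul]
    · refine intervalIntegral.integral_congr fun t _ => ?_
      simp only [smul_smul]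
      ring_nf
    · exact fun t _ => ((hprim t).continuousAt.comp hcontγ.continuousAt).continuousWithinAt
    · intro t ht
      have := (hprim t).scomp t (differentiableAt_of_piecewise hP (by simpa using ht.2)).hasDerivAt
      rwa [hD0] at this
    · exact (intervalIntegrable_deriv_of_piecewise hP _ _).smul_continuousOn hFc.continuousOn
  simp_rw [hftc]
  have hlim := ((hlim2.comp tendsto_snd).sub (hlim1.comp (tendsto_fst (f := atBot)
    (g := atTop)))).const_smul (-Complex.I)
  refine Eq.subst (motive := fun x => Tendsto _ _ (𝓝 x)) ?_ hlim
  set Y := ∫ ρ in Set.Ioi (0 : ℝ), (ρ ^ ((n : ℝ) - α)) • D n (-ρ)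
  -- The cosine parts of the two phases agree and cancel in the difference; the sine parts add up to
  -- `2 i sin(α π)`, and the factor `-i` of `ds_I` makes this real.
  have hexp : ∀ σ : ℝ, σ = 1 ∨ σ = -1 →
      Complex.exp (σ * Real.pi * (((n : ℝ) - α : ℝ) + 1) * Complex.I) =
      (-1) ^ (n + 1) * (Complex.cos (α * Real.pi) - σ * Complex.sin (α * Real.pi) * Complex.I) := by
    intro σ hσ
    have h1 : (σ : ℂ) * Real.pi * (((n : ℝ) - α : ℝ) + 1) * Complex.I =
        ((n + 1 : ℕ) : ℂ) * (σ * Real.pi * Complex.I) + (-(σ * (α * Real.pi))) * Complex.I := by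
      push_cast; ring
    have h2 : Complex.exp (σ * Real.pi * Complex.I) = -1 := by
      rcases hσ with rfl | rfl
      · simp [Complex.exp_pi_mul_I]
      · simp [Complex.exp_neg, Complex.exp_pi_mul_I]
    rw [h1, Complex.exp_add, Complex.exp_nat_mul, h2, Complex.exp_mul_I]
    rcases hσ with rfl | rfl
    · simp; ring
    · simp
  rw [hexp 1 (Or.inl rfl), hexp (-1) (Or.inr rfl), ← Complex.coe_smul, ← Complex.coe_smul,
    ← Complex.coe_smul, smul_smul, smul_smul, ← sub_smul, smul_smul]
  congr 1
  push_cast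
  linear_combination (2 * (partsCoeff α n : ℂ) * (-1) ^ (n + 1) *
    Complex.sin (α * Real.pi)) * (-Complex.I_sq)

end Contour

/-! ### The resolvent function in a Banach ring with a left complex structure -/

section Resolvent

variable {𝒜 : Type*} [NormedRing 𝒜] [NormedSpace ℂ 𝒜] [IsScalarTower ℂ 𝒜 𝒜] [SMulCommClass ℝ 𝒜 𝒜]

/-- The element `1 - 2 Re(z) A + |z|² A²`. -/
def quadElem (A : 𝒜) (z : ℂ) : 𝒜 := 1 - (2 * z.re) • A + (‖z‖ ^ 2) • (A * A)

/-- The element `(z̄ A - 1) A (1 - 2 Re(z) A + |z|² A²)⁻¹`. -/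
def resolventFun (A : 𝒜) (z : ℂ) : 𝒜 :=
  ((starRingEnd ℂ z) • A - 1) * A * Ring.inverse (quadElem A z)

theorem commute_quadElem {A B : 𝒜} (h : Commute B A) (z : ℂ) : Commute B (quadElem A z) := by
  refine ((Commute.one_right B).sub_right ?_).add_right ?_
  · exact h.smul_right _
  · exact (h.mul_right h).smul_right _

theorem commute_quadElem_quadElem (A : 𝒜) (z w : ℂ) : Commute (quadElem A z) (quadElem A w) :=
  commute_quadElem (commute_quadElem (Commute.refl A) z).symm w

theorem continuous_quadElem (A : 𝒜) : Continuous (quadElem A) := by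
  unfold quadElem
  fun_prop

/-- Why the resolvent is holomorphic despite the conjugates: the real coefficients of `quadElem`
pass through `A`, so all complex scalars collect on the left, and with `2 Re z = z + z̄` and `|z|² =
z z̄` the factor `z - w` splits off. -/
theorem resolventFun_numerator (A : 𝒜) (z w : ℂ) :
    ((starRingEnd ℂ z) • A - 1) * A * quadElem A w - ((starRingEnd ℂ w) • A - 1) * A * quadElem A z =
      (z - w) • (-((1 - (starRingEnd ℂ z + starRingEnd ℂ w) • A +
        (starRingEnd ℂ z * starRingEnd ℂ w) • (A * A)) * (A * A))) := by
  have hT : ∀ z : ℂ, ((2 * z.re : ℝ) : ℂ) = z + starRingEnd ℂ z := fun z => by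
    rw [Complex.add_conj]
  have hN : ∀ z : ℂ, ((‖z‖ ^ 2 : ℝ) : ℂ) = z * starRingEnd ℂ z := fun z => by
    rw [Complex.mul_conj, Complex.normSq_eq_norm_sq]
  simp only [quadElem, mul_add, add_mul, mul_sub, sub_mul, smul_mul_assoc, mul_smul_comm, mul_one,
    one_mul, mul_assoc]
  simp only [← Complex.coe_smul, hT, hN]
  module

theorem resolventFun_sub (A : 𝒜) {z w : ℂ} (hz : IsUnit (quadElem A z)) (hw : IsUnit (quadElem A w)) :
    resolventFun A z - resolventFun A w = (z - w) • (-((1 - (starRingEnd ℂ z + starRingEnd ℂ w) • A +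
        (starRingEnd ℂ z * starRingEnd ℂ w) • (A * A)) * (A * A)) *
        (Ring.inverse (quadElem A z) * Ring.inverse (quadElem A w))) := by
  rw [← smul_mul_assoc, ← resolventFun_numerator, sub_mul, resolventFun, resolventFun]
  have h := (commute_quadElem_quadElem A z w).ringInverse_ringInverse
  congr 1
  · rw [h.eq, mul_assoc _ (quadElem A w), Ring.mul_inverse_cancel_left _ _ hw]
  · rw [mul_assoc _ (quadElem A z), Ring.mul_inverse_cancel_left _ _ hz]

variable [CompleteSpace 𝒜]

theorem isOpen_isUnit_quadElem (A : 𝒜) : IsOpen {z : ℂ | IsUnit (quadElem A z)} :=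
  Units.isOpen.preimage (continuous_quadElem A)

/-- By `resolventFun_sub` the difference quotient at `w` equals an expression `K` that is continuous
at `w`, so the derivative is `K w`. -/
theorem hasDerivAt_resolventFun (A : 𝒜) {w : ℂ} (hw : IsUnit (quadElem A w)) :
    HasDerivAt (resolventFun A) (-((1 - (starRingEnd ℂ w + starRingEnd ℂ w) • A +
        (starRingEnd ℂ w * starRingEnd ℂ w) • (A * A)) * (A * A)) *
        (Ring.inverse (quadElem A w) * Ring.inverse (quadElem A w))) w := by
  set K : ℂ → 𝒜 := fun z => -((1 - (starRingEnd ℂ z + starRingEnd ℂ w) • A +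
        (starRingEnd ℂ z * starRingEnd ℂ w) • (A * A)) * (A * A)) *
        (Ring.inverse (quadElem A z) * Ring.inverse (quadElem A w)) with hK
  have hcont : ContinuousAt K w := by
    have h1 : ContinuousAt (fun z => Ring.inverse (quadElem A z)) w := by
      obtain ⟨x, hx⟩ := hw
      refine ContinuousAt.comp (g := Ring.inverse) ?_ (continuous_quadElem A).continuousAt
      rw [← hx]
      exact NormedRing.inverse_continuousAt x
    refine ContinuousAt.mul ?_ (h1.mul continuousAt_const)
    have : Continuous fun z : ℂ => -((1 - (starRingEnd ℂ z + starRingEnd ℂ w) • A +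
        (starRingEnd ℂ z * starRingEnd ℂ w) • (A * A)) * (A * A)) := by
      have := Complex.continuous_conj
      fun_prop
    exact this.continuousAt
  change HasDerivAt (resolventFun A) (K w) w
  rw [hasDerivAt_iff_tendsto_slope]
  refine (hcont.tendsto.mono_left nhdsWithin_le_nhds).congr' ?_
  filter_upwards [self_mem_nhdsWithin,
    mem_nhdsWithin_of_mem_nhds ((isOpen_isUnit_quadElem A).mem_nhds hw)] with z hz hzu
  rw [slope_def_module, resolventFun_sub A hzu hw, smul_smul,
    inv_mul_cancel₀ (sub_ne_zero.2 hz), one_smul]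

theorem differentiableOn_resolventFun (A : 𝒜) :
    DifferentiableOn ℂ (resolventFun A) {z : ℂ | IsUnit (quadElem A z)} := fun _ hw =>
  (hasDerivAt_resolventFun A hw).differentiableAt.differentiableWithinAt

theorem quadElem_neg_real (A : 𝒜) (t : ℝ) :
    quadElem A (-t) = (1 + t • A) * (1 + t • A) := by
  simp only [quadElem, mul_add, add_mul, smul_mul_assoc, mul_smul_comm, mul_one, one_mul]
  simp
  module

/-- At `-t` the quadratic is the square of `1 + t A`, and one factor cancels against the numerator.
-/
theorem resolventFun_neg_real (A : 𝒜) {t : ℝ} (ht : IsUnit (1 + t • A)) :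
    resolventFun A (-t) = -(A * Ring.inverse (1 + t • A)) := by
  have hc : Commute A (1 + t • A) := (Commute.one_right A).add_right ((Commute.refl A).smul_right t)
  have h1 : (starRingEnd ℂ (-(t : ℂ))) • A - 1 = -(1 + t • A) := by
    rw [map_neg, Complex.conj_ofReal, neg_smul, Complex.coe_smul]
    abel
  rw [resolventFun, quadElem_neg_real, h1, neg_mul, ← hc.eq]
  rw [Ring.mul_inverse_rev' (Commute.refl _)]
  rw [neg_mul, mul_assoc, ← mul_assoc (1 + t • A), Ring.mul_inverse_cancel _ ht, one_mul]

/-- The identity `q_z(A) = (1 + t A)² q_{z + t}(R)` for `R = A (1 + t A)⁻¹`. -/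
theorem quadElem_eq_mul {A R : 𝒜} {t : ℝ} (hR : (1 + t • A) * R = A) (hR' : R * (1 + t • A) = A)
    (z : ℂ) : quadElem A z = (1 + t • A) * (1 + t • A) * quadElem R (z + t) := by
  have hN : ‖z + t‖ ^ 2 = ‖z‖ ^ 2 + 2 * t * z.re + t ^ 2 := by
    rw [← Complex.normSq_eq_norm_sq, ← Complex.normSq_eq_norm_sq, Complex.normSq_apply,
      Complex.normSq_apply]
    simp
    ring
  have h1 : (1 + t • A) * (1 + t • A) * R = A + t • (A * A) := by
    rw [mul_assoc, hR, add_mul, one_mul, smul_mul_assoc]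
  have h2 : (1 + t • A) * (1 + t • A) * (R * R) = A * A := by
    have h3 : A * R = R * A := by
      conv_lhs => rw [← hR', mul_assoc, hR]
    rw [mul_assoc (1 + t • A), ← mul_assoc (1 + t • A) R, hR, h3, ← mul_assoc, hR]
  rw [quadElem, quadElem, mul_add, mul_sub, mul_one, mul_smul_comm, mul_smul_comm, h1, h2, hN]
  simp only [mul_add, add_mul, smul_mul_assoc, mul_smul_comm, mul_one, one_mul, Complex.add_re,
    Complex.ofReal_re]
  module

/-- Perturbation around `-t`: after extracting the unit `(1 + t A)²`, what remains of the quadratic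
is `1 - N` with `N` small when `|z + t| ‖R‖` is small, and a Neumann series inverts it. -/
theorem isUnit_quadElem_and_norm_le {A : 𝒜} {t : ℝ} (ht : IsUnit (1 + t • A)) {z : ℂ}
    (hz : ‖z + t‖ * ‖A * Ring.inverse (1 + t • A)‖ ≤ 1 / 4) :
    IsUnit (quadElem A z) ∧ ‖resolventFun A z‖ ≤ 3 * ‖A * Ring.inverse (1 + t • A)‖ := by
  set u := 1 + t • A with hu
  set R := A * Ring.inverse u with hRdef
  have hc : Commute A u := (Commute.one_right A).add_right ((Commute.refl A).smul_right t)
  have hR' : R * u = A := by rw [hRdef, mul_assoc, Ring.inverse_mul_cancel _ ht, mul_one]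
  have hR : u * R = A := by
    rw [hRdef, ← mul_assoc, ← hc.eq, mul_assoc, Ring.mul_inverse_cancel _ ht, mul_one]
  have hq := quadElem_eq_mul hR hR' z
  set w : ℂ := z + t with hw
  set N : 𝒜 := (2 * w.re) • R - (‖w‖ ^ 2) • (R * R) with hNdef
  have hqN : quadElem R w = 1 - N := by rw [quadElem, hNdef]; abel
  have hNn : ‖N‖ ≤ 9 / 16 := by
    have h1 : ‖(2 * w.re) • R‖ ≤ 1 / 2 := by
      rw [norm_smul, norm_mul, Real.norm_eq_abs, Real.norm_eq_abs, abs_two]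
      nlinarith [Complex.abs_re_le_norm w, norm_nonneg R]
    have h2 : ‖(‖w‖ ^ 2) • (R * R)‖ ≤ 1 / 16 := by
      rw [norm_smul, Real.norm_of_nonneg (by positivity)]
      have h3 : 0 ≤ ‖w‖ * ‖R‖ := by positivity
      calc ‖w‖ ^ 2 * ‖R * R‖ ≤ ‖w‖ ^ 2 * (‖R‖ * ‖R‖) :=
            mul_le_mul_of_nonneg_left (norm_mul_le _ _) (by positivity)
        _ = (‖w‖ * ‖R‖) * (‖w‖ * ‖R‖) := by ring
        _ ≤ 1 / 16 := by nlinarith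
    exact (norm_sub_le _ _).trans (by linarith)
  have hqu : IsUnit (quadElem R w) := by
    rw [hqN]
    exact isUnit_one_sub_of_norm_lt_one (by linarith)
  have hunit : IsUnit (quadElem A z) := by rw [hq]; exact (ht.mul ht).mul hqu
  refine ⟨hunit, ?_⟩
  -- The factor `(1 + t A)²` is cancelled on the right; it commutes with `quadElem R w`, and `z̄ A -
  -- (1 + t A)(1 - …)` never arises because `(w̄ R - 1)(1 + t A) = z̄ A - 1`.
  have h1 : resolventFun A z * quadElem R w = ((starRingEnd ℂ w) • R - 1) * R := by
    have huR : Commute u R := by rw [Commute, SemiconjBy, hR, hR']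
    have hcom : (u * u) * quadElem R w = quadElem R w * (u * u) :=
      ((commute_quadElem huR w).mul_left (commute_quadElem huR w)).eq
    refine (ht.mul ht).mul_right_cancel ?_
    rw [mul_assoc, ← hcom, ← hq, resolventFun, mul_assoc _ (Ring.inverse _),
      Ring.inverse_mul_cancel _ hunit, mul_one, mul_assoc _ R, ← mul_assoc R, hR', hc.eq,
      ← mul_assoc _ u]
    congr 1
    rw [sub_mul, one_mul, smul_mul_assoc, hR', hw, map_add, Complex.conj_ofReal, add_smul,
      Complex.coe_smul, hu]
    abel
  have h2 : resolventFun A z = ((starRingEnd ℂ w) • R - 1) * R + resolventFun A z * N := by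
    rw [← h1, hqN]
    noncomm_ring
  have h3 : ‖((starRingEnd ℂ w) • R - 1) * R‖ ≤ 5 / 4 * ‖R‖ := by
    rw [sub_mul, one_mul]
    refine (norm_sub_le _ _).trans ?_
    have : ‖(starRingEnd ℂ w) • R * R‖ ≤ ‖w‖ * ‖R‖ * ‖R‖ := by
      refine (norm_mul_le _ _).trans ?_
      rw [norm_smul, Complex.norm_conj]
    nlinarith [norm_nonneg R]
  have h4 : ‖resolventFun A z‖ ≤ 5 / 4 * ‖R‖ + ‖resolventFun A z‖ * (9 / 16) := by
    conv_lhs => rw [h2]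
    refine (norm_add_le _ _).trans (add_le_add h3 ((norm_mul_le _ _).trans ?_))
    exact mul_le_mul_of_nonneg_left hNn (norm_nonneg _)
  -- Absorbing the last term gives the factor `(5/4) / (7/16) = 20/7 ≤ 3`.
  linarith [norm_nonneg R]

end Resolvent

/-- A function decaying like `(1 + t) ^ (-(n + 1))` is integrable against `t ^ (n - α)`. -/
theorem integrableOn_rpow_smul_of_norm_le {W : Type*} [NormedAddCommGroup W] [NormedSpace ℝ W]
    {f : ℝ → W} {n : ℕ} {α C : ℝ} (hα0 : 0 < α) (hα : α < n + 1)
    (hf : ContinuousOn f (Set.Ioi 0)) (hC : ∀ t, 0 < t → ‖f t‖ ≤ C / (1 + t) ^ (n + 1)) :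
    IntegrableOn (fun t : ℝ => (t ^ ((n : ℝ) - α)) • f t) (Set.Ioi 0) := by
  have hC0 : 0 ≤ C := by
    have := (norm_nonneg _).trans (hC 1 one_pos)
    by_contra h
    exact absurd this (not_le.2 (div_neg_of_neg_of_pos (not_le.1 h) (by positivity)))
  have hcont : ContinuousOn (fun t : ℝ => (t ^ ((n : ℝ) - α)) • f t) (Set.Ioi 0) := by
    have h : ContinuousOn (fun t : ℝ => t ^ ((n : ℝ) - α)) (Set.Ioi 0) := fun t ht =>
      (Real.continuousAt_rpow_const t _ (Or.inl (ne_of_gt ht))).continuousWithinAt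
    exact h.smul hf
  -- Near `0` the exponent `n - α > -1` is what counts; beyond `1` the decay leaves `t ^ (-α - 1)`.
  rw [← Set.Ioc_union_Ioi_eq_Ioi zero_le_one]
  refine IntegrableOn.union ?_ ?_
  · have h1 : IntegrableOn (fun t : ℝ => t ^ ((n : ℝ) - α) * C) (Set.Ioc 0 1) := by
      have := (intervalIntegral.intervalIntegrable_rpow' (a := 0) (b := 1)
        (show -1 < (n : ℝ) - α by linarith)).mul_const C
      rwa [intervalIntegrable_iff_integrableOn_Ioc_of_le zero_le_one] at this
    refine Integrable.mono' h1
      ((hcont.mono fun t ht => ht.1).aestronglyMeasurable measurableSet_Ioc) ?_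
    refine (ae_restrict_iff' measurableSet_Ioc).2 (Eventually.of_forall fun t ht => ?_)
    rw [norm_smul, Real.norm_of_nonneg (Real.rpow_nonneg ht.1.le _)]
    refine mul_le_mul_of_nonneg_left ((hC t ht.1).trans ?_) (Real.rpow_nonneg ht.1.le _)
    exact div_le_self hC0 (one_le_pow₀ (by linarith [ht.1]))
  · have h1 : IntegrableOn (fun t : ℝ => C * t ^ (-α - 1)) (Set.Ioi 1) :=
      (integrableOn_Ioi_rpow_of_lt (by linarith) one_pos).const_mul C
    refine Integrable.mono' h1
      ((hcont.mono (Set.Ioi_subset_Ioi zero_le_one)).aestronglyMeasurable measurableSet_Ioi) ?_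
    refine (ae_restrict_iff' measurableSet_Ioi).2 (Eventually.of_forall fun t ht => ?_)
    have ht0 : 0 < t := lt_trans one_pos (Set.mem_Ioi.1 ht)
    rw [norm_smul, Real.norm_of_nonneg (Real.rpow_nonneg ht0.le _)]
    refine (mul_le_mul_of_nonneg_left (hC t ht0) (Real.rpow_nonneg ht0.le _)).trans ?_
    have h2 : t ^ ((n : ℝ) - α) = t ^ (-α - 1) * t ^ (n + 1) := by
      rw [← Real.rpow_add_natCast ht0.ne']
      push_cast
      ring_nf
    have h3 : t ^ (n + 1) ≤ (1 + t) ^ (n + 1) := pow_le_pow_left₀ ht0.le (by linarith) _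
    have h4 : (0 : ℝ) < (1 + t) ^ (n + 1) := by positivity
    have h5 : 0 ≤ t ^ (-α - 1) := Real.rpow_nonneg ht0.le _
    rw [h2, mul_div_assoc', div_le_iff₀ h4]
    calc t ^ (-α - 1) * t ^ (n + 1) * C = C * t ^ (-α - 1) * t ^ (n + 1) := by ring
      _ ≤ C * t ^ (-α - 1) * (1 + t) ^ (n + 1) :=
        mul_le_mul_of_nonneg_left h3 (mul_nonneg hC0 h5)

/-! ### Powers of the resolvent on the negative half line, and extension to a sector -/

section Resolvent

variable {𝒜 : Type*} [NormedRing 𝒜] [NormedSpace ℂ 𝒜] [IsScalarTower ℂ 𝒜 𝒜] [SMulCommClass ℝ 𝒜 𝒜]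

/-- The element `A (1 + t A)⁻¹`, that is `(t + A⁻¹)⁻¹`. -/
def realResolvent (A : 𝒜) (t : ℝ) : 𝒜 := A * Ring.inverse (1 + t • A)

/-- Only real scalars commute with multiplication on both sides, so the product rule is taken in the
underlying real normed algebra. -/
theorem hasDerivAt_mul_of_smulCommClass {f g : ℝ → 𝒜} {f' g' : 𝒜} {t : ℝ} (hf : HasDerivAt f f' t)
    (hg : HasDerivAt g g' t) : HasDerivAt (fun t => f t * g t) (f' * g t + f t * g') t := by
  let _ : NormedAlgebra ℝ 𝒜 :=
    { Algebra.ofModule (fun r x y => smul_mul_assoc r x y) (fun r x y => mul_smul_comm r x y) with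
      norm_smul_le := fun r x => norm_smul_le r x }
  exact HasDerivAt.mul hf hg

variable [CompleteSpace 𝒜]

theorem isOpen_isUnit_one_add_smul (A : 𝒜) : IsOpen {t : ℝ | IsUnit (1 + t • A)} :=
  Units.isOpen.preimage (by fun_prop : Continuous fun t : ℝ => 1 + t • A)

theorem hasDerivAt_comp_neg_real {W : Type*} [NormedAddCommGroup W] [NormedSpace ℂ W]
    {F : ℂ → W} {F' : W} {t : ℝ} (h : HasDerivAt F F' (-t)) :
    HasDerivAt (fun t : ℝ => F (-t)) (-F') t := by
  have h0 : HasDerivAt (fun t : ℝ => (t : ℂ)) 1 t := by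
    simpa using (hasDerivAt_id t).ofReal_comp
  exact (h.scomp t h0.fun_neg).congr_deriv (by simp)

theorem hasDerivAt_realResolvent (A : 𝒜) {t : ℝ} (ht : IsUnit (1 + t • A)) :
    HasDerivAt (realResolvent A) (-(realResolvent A t * realResolvent A t)) t := by
  have hq : IsUnit (quadElem A (-t)) := by rw [quadElem_neg_real]; exact ht.mul ht
  have hc : Commute A (1 + t • A) := (Commute.one_right A).add_right ((Commute.refl A).smul_right t)
  have h := (hasDerivAt_comp_neg_real (hasDerivAt_resolventFun A hq)).neg
  have hev : realResolvent A =ᶠ[𝓝 t] fun t : ℝ => -resolventFun A (-t) := by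
    filter_upwards [(isOpen_isUnit_one_add_smul A).mem_nhds ht] with s hs
    rw [resolventFun_neg_real A hs, neg_neg, realResolvent]
  refine (h.congr_of_eventuallyEq hev).congr_deriv ?_
  have h1 : (1 : 𝒜) - (starRingEnd ℂ (-(t : ℂ)) + starRingEnd ℂ (-(t : ℂ))) • A +
      (starRingEnd ℂ (-(t : ℂ)) * starRingEnd ℂ (-(t : ℂ))) • (A * A) =
      (1 + t • A) * (1 + t • A) := by
    simp only [mul_add, add_mul, smul_mul_assoc, mul_smul_comm, mul_one, one_mul, map_neg,
      Complex.conj_ofReal]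
    simp only [← Complex.coe_smul]
    module
  rw [h1, quadElem_neg_real, Ring.mul_inverse_rev' (Commute.refl _), realResolvent]
  set u := 1 + t • A
  have hcu : Commute A (Ring.inverse u) := by
    refine ht.mul_left_cancel ?_
    rw [← mul_assoc, ← hc.eq, mul_assoc, Ring.mul_inverse_cancel _ ht, ← mul_assoc,
      Ring.mul_inverse_cancel _ ht, one_mul, mul_one]
  have hA : u * u * (A * A) = A * A * (u * u) :=
    ((hc.mul_left hc).mul_right (hc.mul_left hc)).eq.symm
  rw [hA]
  have h2 : A * A * (u * u) * (Ring.inverse u * Ring.inverse u * (Ring.inverse u * Ring.inverse u)) =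
      A * Ring.inverse u * (A * Ring.inverse u) := by
    have h3 : u * u * (Ring.inverse u * Ring.inverse u * (Ring.inverse u * Ring.inverse u)) =
        Ring.inverse u * Ring.inverse u := by
      simp only [mul_assoc, Ring.mul_inverse_cancel_left _ _ ht]
    calc _ = A * A * (Ring.inverse u * Ring.inverse u) := by rw [mul_assoc (A * A), h3]
      _ = A * (A * Ring.inverse u) * Ring.inverse u := by simp only [mul_assoc]
      _ = A * Ring.inverse u * (A * Ring.inverse u) := by
          conv_lhs => rw [hcu.eq]
          simp only [mul_assoc]
  rw [neg_mul, h2, neg_neg]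

theorem hasDerivAt_realResolvent_pow (A : 𝒜) {t : ℝ} (ht : IsUnit (1 + t • A)) (m : ℕ) :
    HasDerivAt (fun t => realResolvent A t ^ (m + 1))
      (-((m + 1 : ℝ) • realResolvent A t ^ (m + 2))) t := by
  induction m with
  | zero => simpa [pow_two] using hasDerivAt_realResolvent A ht
  | succ m ih =>
    simp only [pow_succ _ (m + 1)]
    refine (hasDerivAt_mul_of_smulCommClass ih (hasDerivAt_realResolvent A ht)).congr_deriv ?_
    rw [neg_mul, smul_mul_assoc, mul_neg, ← mul_assoc, ← pow_succ, ← pow_succ, ← pow_succ]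
    push_cast
    module

/-- Iteration of `R' = -R²`; the sign from each differentiation of the power cancels the one from
the substitution `z = -t`. -/
theorem iteratedDeriv_resolventFun_neg_real (A : 𝒜) (n : ℕ) {t : ℝ} (ht : IsUnit (1 + t • A)) :
    iteratedDeriv n (resolventFun A) (-t) = -((n.factorial : ℝ) • realResolvent A t ^ (n + 1)) := by
  induction n generalizing t with
  | zero => simp [resolventFun_neg_real A ht, realResolvent]
  | succ n ih =>
    have hq : IsUnit (quadElem A (-t)) := by rw [quadElem_neg_real]; exact ht.mul ht
    have h1 := hasDerivAt_comp_neg_real (hasDerivAt_iteratedDeriv (isOpen_isUnit_quadElem A)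
      (differentiableOn_resolventFun A) n hq)
    have h2 := ((hasDerivAt_realResolvent_pow A ht n).const_smul (n.factorial : ℝ)).neg
    have hev : (fun t : ℝ => iteratedDeriv n (resolventFun A) (-t)) =ᶠ[𝓝 t]
        fun t => -((n.factorial : ℝ) • realResolvent A t ^ (n + 1)) := by
      filter_upwards [(isOpen_isUnit_one_add_smul A).mem_nhds ht] with s hs
      exact ih hs
    have h3 := h1.unique (h2.congr_of_eventuallyEq hev)
    rw [neg_eq_iff_eq_neg] at h3
    rw [h3, Nat.factorial_succ]
    push_cast
    module

theorem continuousOn_realResolvent_pow (A : 𝒜) (hA : ∀ t : ℝ, 0 ≤ t → IsUnit (1 + t • A)) (m : ℕ) :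
    ContinuousOn (fun t => realResolvent A t ^ (m + 1)) (Set.Ioi 0) := fun t ht =>
  (hasDerivAt_realResolvent_pow A (hA t (le_of_lt ht)) m).continuousAt.continuousWithinAt

theorem norm_realResolvent_pow_le {A : 𝒜} {M : ℝ}
    (hM : ∀ t : ℝ, 0 ≤ t → ‖realResolvent A t‖ ≤ M / (1 + t)) (m : ℕ) {t : ℝ} (ht : 0 ≤ t) :
    ‖realResolvent A t ^ (m + 1)‖ ≤ M ^ (m + 1) / (1 + t) ^ (m + 1) := by
  refine (norm_pow_le' _ m.succ_pos).trans ?_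
  rw [← div_pow]
  exact pow_le_pow_left₀ (norm_nonneg _) (hM t ht) _

/-- The cosine of the angle of a sector to which a resolvent bounded by `M / (1 + t)` on the
negative half line extends. -/
def sectorCos (M : ℝ) : ℝ := -(Real.sqrt (1 + (1 / (8 * M)) ^ 2))⁻¹

theorem sectorCos_mem_Ioo {M : ℝ} (hM : 0 < M) : sectorCos M ∈ Set.Ioo (-1) 0 := by
  have hε : 0 < 1 / (8 * M) := by positivity
  have hs : 1 < Real.sqrt (1 + (1 / (8 * M)) ^ 2) := by
    rw [Real.lt_sqrt zero_le_one]; nlinarith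
  exact ⟨neg_lt_neg (inv_lt_one_of_one_lt₀ hs), neg_neg_of_pos (by positivity)⟩

/-- The resolvent extends from the negative half line to a sector. -/
theorem isUnit_quadElem_and_norm_le_of_mem_sector {A : 𝒜} (hA : ∀ t : ℝ, 0 ≤ t → IsUnit (1 + t • A)) {M : ℝ} (hM1 : 1 ≤ M)
    (hM : ∀ t : ℝ, 0 ≤ t → ‖realResolvent A t‖ ≤ M / (1 + t)) :
    ∀ z ∈ cone' (sectorCos M) (1 / (16 * M)),
      IsUnit (quadElem A z) ∧ ‖resolventFun A z‖ ≤ 6 * M / (1 + ‖z‖) := by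
  intro z hz
  set ε : ℝ := 1 / (8 * M) with hε
  set a : ℝ := 1 / (16 * M) with ha
  have hM0 : 0 < M := by linarith
  have hε0 : 0 < ε := by positivity
  have ha0 : 0 < a := by positivity
  have hεM : ε * M = 1 / 8 := by rw [hε]; field_simp
  have haM : a * M = 1 / 16 := by rw [ha]; field_simp
  have hε1 : ε ≤ 1 / 8 := by nlinarith
  have ha1 : a ≤ 1 / 16 := by nlinarith
  set κ : ℝ := (Real.sqrt (1 + ε ^ 2))⁻¹ with hκ
  have hκ0 : 0 < κ := by positivity
  have hκ2 : κ ^ 2 * (1 + ε ^ 2) = 1 := by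
    rw [hκ, inv_pow, Real.sq_sqrt (by positivity)]
    field_simp
  have hz' : z.re - a ≤ -κ * ‖z - a‖ := hz
  have hxa : 0 ≤ a - z.re := by nlinarith [norm_nonneg (z - a)]
  have hns : ‖z - a‖ ^ 2 = (a - z.re) ^ 2 + z.im ^ 2 := by
    rw [← Complex.normSq_eq_norm_sq, Complex.normSq_apply]
    simp
    ring
  -- The value `sectorCos M = -(1 + ε²)^{-1/2}` is the cosine for which the cone condition becomes
  -- the slope condition `|Im z| ≤ ε (a - Re z)`.
  have hy : |z.im| ≤ ε * (a - z.re) := by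
    refine abs_le_of_sq_le_sq ?_ (by positivity)
    have h1 : (κ * ‖z - a‖) ^ 2 ≤ (a - z.re) ^ 2 :=
      pow_le_pow_left₀ (by positivity) (by linarith) 2
    rw [mul_pow, hns] at h1
    have h2 := mul_le_mul_of_nonneg_right h1 (show 0 ≤ 1 + ε ^ 2 by positivity)
    nlinarith
  have hzn : ‖z‖ ≤ |z.re| + |z.im| := Complex.norm_le_abs_re_add_abs_im z
  have main : ∀ t : ℝ, 0 ≤ t → ‖z + t‖ ≤ ε * 2 * (1 + t) → 1 + ‖z‖ ≤ 2 * (1 + t) →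
      IsUnit (quadElem A z) ∧ ‖resolventFun A z‖ ≤ 6 * M / (1 + ‖z‖) := by
    intro t ht h1 h2
    have h3 := hM t ht
    have h4 : ‖z + t‖ * ‖realResolvent A t‖ ≤ 1 / 4 := by
      calc ‖z + t‖ * ‖realResolvent A t‖ ≤ (ε * 2 * (1 + t)) * (M / (1 + t)) :=
            mul_le_mul h1 h3 (norm_nonneg _) (by positivity)
        _ = ε * M * 2 := by field_simp
        _ = 1 / 4 := by rw [hεM]; norm_num
    obtain ⟨h5, h6⟩ := isUnit_quadElem_and_norm_le (hA t ht) h4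
    refine ⟨h5, h6.trans ?_⟩
    change 3 * ‖realResolvent A t‖ ≤ _
    rw [le_div_iff₀ (by positivity)]
    rw [le_div_iff₀ (by positivity)] at h3
    nlinarith [norm_nonneg (realResolvent A t)]
  -- The centre of perturbation is `Re z` when this is nonpositive, and otherwise `0`: to the right
  -- of the imaginary axis the sector is a tip of size at most `a = ε / 2`.
  rcases le_total z.re 0 with hx | hx
  · refine main (-z.re) (by linarith) ?_ ?_
    · have : z + ((-z.re : ℝ) : ℂ) = z.im * Complex.I := by
        apply Complex.ext <;> simp
      rw [this, norm_mul, Complex.norm_I, Complex.norm_real, mul_one, Real.norm_eq_abs]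
      nlinarith
    · rw [abs_of_nonpos hx] at hzn
      nlinarith
  · rw [abs_of_nonneg hx] at hzn
    refine main 0 le_rfl ?_ ?_
    · rw [Complex.ofReal_zero, add_zero]
      have : a = ε / 2 := by rw [ha, hε]; field_simp; norm_num
      nlinarith
    · nlinarith

end Resolvent

/-! ### Complex slices of the quaternions -/

section Slice

theorem mul_self_of_mem_imagUnits {I : ℍ[ℝ]} (hI : I ∈ imagUnits) : I * I = -1 := by
  have h1 : star I = -I := by
    rw [Quaternion.star_eq_neg]
    exact hI.1
  have h2 := Quaternion.self_mul_star I
  rw [h1, mul_neg, Quaternion.normSq_eq_norm_mul_self, hI.2] at h2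
  rw [← neg_eq_iff_eq_neg, h2]
  simp

/-- The embedding `x + i y ↦ x + I y` of `ℂ` onto the slice `ℂ_I`. -/
def sliceHom (I : imagUnits) : ℂ →ₐ[ℝ] ℍ[ℝ] :=
  Complex.liftAux I.1 (mul_self_of_mem_imagUnits I.2)

variable (I : imagUnits)

theorem sliceHom_apply (z : ℂ) : sliceHom I z = (z.re : ℍ[ℝ]) + z.im • I.1 := rfl

theorem sliceHom_ofReal (r : ℝ) : sliceHom I (r : ℂ) = (r : ℍ[ℝ]) := by
  simp

theorem sliceHom_I : sliceHom I Complex.I = I.1 := by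
  simp [sliceHom_apply]

theorem re_sliceHom (z : ℂ) : (sliceHom I z).re = z.re := by
  simp [sliceHom_apply, I.2.1]

theorem im_sliceHom (z : ℂ) : (sliceHom I z).im = z.im • I.1 := by
  have : (I.1).im = I.1 := by
    have := I.1.re_add_im
    rw [I.2.1] at this
    simpa using this
  rw [sliceHom_apply, Quaternion.im_add, Quaternion.im_coe, Quaternion.im_smul, this, zero_add]

theorem star_sliceHom (z : ℂ) : star (sliceHom I z) = sliceHom I (starRingEnd ℂ z) := by
  rw [sliceHom_apply, sliceHom_apply, star_add, Quaternion.star_smul, Quaternion.star_coe,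
    Quaternion.star_eq_neg.2 I.2.1]
  simp

theorem norm_sliceHom (z : ℂ) : ‖sliceHom I z‖ = ‖z‖ := by
  have h := Quaternion.self_mul_star (sliceHom I z)
  rw [star_sliceHom, ← map_mul, Complex.mul_conj, sliceHom_ofReal, Quaternion.coe_inj,
    Quaternion.normSq_eq_norm_mul_self, Complex.normSq_eq_norm_sq, ← pow_two] at h
  exact ((pow_left_inj₀ (norm_nonneg _) (norm_nonneg _) two_ne_zero).1 h).symm

theorem continuous_sliceHom : Continuous (sliceHom I) := by
  have : sliceHom I = fun z : ℂ => (z.re : ℍ[ℝ]) + z.im • I.1 := rfl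
  rw [this]
  have := Quaternion.continuous_coe
  fun_prop

theorem sliceHom_injective : Function.Injective (sliceHom I) := (sliceHom I).toRingHom.injective

/-- A continuous coordinate on the slice, used to pull a quaternionic path back to a complex one
without losing smoothness. -/
theorem exists_leftInverse_sliceHom : ∃ g : ℍ[ℝ] →L[ℝ] ℂ, ∀ z, g (sliceHom I z) = z := by
  obtain ⟨g, hg⟩ := (sliceHom I).toLinearMap.exists_leftInverse_of_injective
    (LinearMap.ker_eq_bot.2 (sliceHom_injective I))
  exact ⟨LinearMap.toContinuousLinearMap g, fun z => LinearMap.congr_fun hg z⟩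

theorem mem_slicePlane_iff {s : ℍ[ℝ]} : s ∈ slicePlane I.1 ↔ ∃ z, sliceHom I z = s := by
  constructor
  · rintro ⟨x, y, rfl⟩
    refine ⟨⟨x, y⟩, ?_⟩
    rw [sliceHom_apply, Quaternion.mul_coe_eq_smul]
  · rintro ⟨z, rfl⟩
    refine ⟨z.re, z.im, ?_⟩
    rw [sliceHom_apply, Quaternion.mul_coe_eq_smul]

theorem sliceHom_mem_negHalfLine_iff {z : ℂ} :
    sliceHom I z ∈ negHalfLine ↔ z ∉ Complex.slitPlane := by
  rw [Complex.mem_slitPlane_iff_not_le_zero, not_not]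
  constructor
  · rintro ⟨r, hr, h⟩
    rw [← sliceHom_ofReal I] at h
    rw [sliceHom_injective I h]
    exact_mod_cast hr
  · intro h
    obtain ⟨h1, h2⟩ := Complex.le_def.1 h
    refine ⟨z.re, h1, ?_⟩
    rw [sliceHom_apply, h2]
    simp

theorem sliceHom_mem_closedSector_iff {θ a : ℝ} (h0 : 0 < θ) (hπ : θ < Real.pi) {z : ℂ} :
    sliceHom I z ∈ closedSector θ a ↔ z ∈ cone' (Real.cos θ) a := by
  have h1 : sliceHom I z - (a : ℍ[ℝ]) = sliceHom I (z - a) := by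
    rw [map_sub, sliceHom_ofReal]
  have h2 : sliceHom I z ∈ closedSector θ a ↔ z = a ∨
      θ ≤ Real.arccos ((z - a).re / ‖z - a‖) := by
    rw [closedSector, Set.mem_ofPred_eq, h1, qarg, re_sliceHom, norm_sliceHom,
      ← sliceHom_ofReal I, (sliceHom_injective I).eq_iff]
  rw [h2]
  change _ ↔ z.re - a ≤ Real.cos θ * ‖z - a‖
  by_cases hz : z = a
  · simp [hz]
  have hpos : 0 < ‖z - a‖ := norm_pos_iff.2 (sub_ne_zero.2 hz)
  simp only [hz, false_or]
  rw [← div_le_iff₀ hpos]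
  have h3 : z.re - a = (z - a).re := by simp
  rw [h3]
  have h4 := abs_le.1 (Complex.abs_re_div_norm_le_one (z - a))
  constructor
  · intro h
    have := Real.cos_le_cos_of_nonneg_of_le_pi h0.le (Real.arccos_le_pi _) h
    rwa [Real.cos_arccos h4.1 h4.2] at this
  · intro h
    have := Real.arccos_le_arccos h
    rwa [Real.arccos_cos h0.le hπ.le] at this

/-- Below the real axis `I_s = -I` while the quaternionic argument stays in `[0, π]`; the two sign
changes combine to the complex argument. On the positive axis both vanish. -/
theorem qlog_sliceHom {z : ℂ} (hz : z ∈ Complex.slitPlane) :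
    qlog (sliceHom I z) = sliceHom I (Complex.log z) := by
  rw [qlog, qunit, qarg, im_sliceHom, re_sliceHom, norm_sliceHom, sliceHom_apply, Complex.log_re,
    Complex.log_im]
  congr 1
  rw [Quaternion.mul_coe_eq_smul, norm_smul, I.2.2, mul_one, smul_smul, smul_smul]
  rcases lt_trichotomy z.im 0 with h | h | h
  · rw [Complex.arg_of_im_neg h, Real.norm_of_nonpos h.le]
    congr 1
    have := h.ne
    field_simp
  · have : 0 < z.re := by
      rcases hz with h' | h'
      · exact h'
      · exact absurd h h'
    have h2 : z.arg = 0 := Complex.arg_eq_zero_iff.2 ⟨this.le, h⟩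
    rw [h, h2]
    simp
  · rw [Complex.arg_of_im_pos h, Real.norm_of_nonneg h.le]
    congr 1
    field_simp

theorem exp_sliceHom (z : ℂ) : NormedSpace.exp (sliceHom I z) = sliceHom I (Complex.exp z) := by
  rw [Complex.exp_eq_exp_ℂ]
  exact (NormedSpace.map_exp (sliceHom I) (continuous_sliceHom I) z).symm

theorem qpow_sliceHom {z : ℂ} (hz : z ∈ Complex.slitPlane) (α : ℝ) :
    qpow (sliceHom I z) α = sliceHom I (z ^ (α : ℂ)) := by
  rw [qpow, qlog_sliceHom I hz, ← map_smul, exp_sliceHom,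
    Complex.cpow_def_of_ne_zero (Complex.slitPlane_ne_zero hz), Complex.real_smul, mul_comm]

theorem exp_smul_imagUnit (θ : ℝ) :
    NormedSpace.exp (θ • I.1) = sliceHom I (Complex.exp (θ * Complex.I)) := by
  rw [← exp_sliceHom, ← Complex.real_smul, map_smul, sliceHom_I]

theorem exists_sliceHom_eq (s : ℍ[ℝ]) : ∃ (J : imagUnits) (z : ℂ), sliceHom J z = s := by
  by_cases h : s.im = 0
  · obtain ⟨i, hi, hi'⟩ : ∃ i : ℍ[ℝ], i.re = 0 ∧ Quaternion.normSq i = 1 :=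
      ⟨(Complex.I : ℂ), by simp, by rw [Quaternion.normSq_def']; simp⟩
    rw [Quaternion.normSq_eq_norm_mul_self] at hi'
    have h1 : i ∈ imagUnits := ⟨hi, by nlinarith [norm_nonneg i]⟩
    refine ⟨⟨_, h1⟩, s.re, ?_⟩
    rw [sliceHom_ofReal]
    conv_rhs => rw [← s.re_add_im, h, add_zero]
  · have h0 : ‖s.im‖ ≠ 0 := norm_ne_zero_iff.2 h
    have h1 : ‖s.im‖⁻¹ • s.im ∈ imagUnits := by
      refine ⟨by simp, ?_⟩
      rw [norm_smul, norm_inv, norm_norm, inv_mul_cancel₀ h0]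
    refine ⟨⟨_, h1⟩, ⟨s.re, ‖s.im‖⟩, ?_⟩
    rw [sliceHom_apply]
    simp only
    rw [smul_inv_smul₀ h0, s.re_add_im]

end Slice

/-! ### Bounded operators as a complex Banach ring -/

section SliceOp

variable {V : Type*} [NormedAddCommGroup V] [NormedSpace ℝ V]
  [Module ℍ[ℝ] V] [IsScalarTower ℝ ℍ[ℝ] V] [NormSMulClass ℍ[ℝ] V]

/-- The ring of bounded real linear operators, with the complex structure given by left
multiplication by elements of the slice `ℂ_I`. -/
def SliceOp (_ : imagUnits) (V : Type*) [NormedAddCommGroup V] [NormedSpace ℝ V] : Type _ :=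
  V →L[ℝ] V

variable (I : imagUnits)

instance : NormedRing (SliceOp I V) := inferInstanceAs (NormedRing (V →L[ℝ] V))

instance [CompleteSpace V] : CompleteSpace (SliceOp I V) :=
  inferInstanceAs (CompleteSpace (V →L[ℝ] V))

instance : Module ℂ (SliceOp I V) :=
  Module.compHom (V →L[ℝ] V) (sliceHom I : ℂ →+* ℍ[ℝ])

theorem sliceOp_smul_apply (z : ℂ) (f : SliceOp I V) (v : V) :
    (show V →L[ℝ] V from z • f) v = sliceHom I z • (show V →L[ℝ] V from f) v := rfl

instance : NormedSpace ℂ (SliceOp I V) where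
  norm_smul_le z f := by
    refine ContinuousLinearMap.opNorm_le_bound (show V →L[ℝ] V from z • f) (by positivity)
      fun v => ?_
    rw [sliceOp_smul_apply, norm_smul, norm_sliceHom, mul_assoc]
    exact mul_le_mul_of_nonneg_left (ContinuousLinearMap.le_opNorm _ v) (norm_nonneg z)

/-- Scalars act on the output of the left factor of a composition. The companion `SMulCommClass` is
only available over `ℝ`, since these operators need not be left linear. -/
instance : IsScalarTower ℂ (SliceOp I V) (SliceOp I V) := ⟨fun _ _ _ => rfl⟩

/-- The identity map, as an isometric isomorphism of real Banach spaces. -/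
def toSliceOp : (V →L[ℝ] V) ≃ₗᵢ[ℝ] SliceOp I V where
  toFun f := f
  invFun f := f
  map_add' _ _ := rfl
  map_smul' r f := by
    refine ContinuousLinearMap.ext fun v => ?_
    change r • f v = sliceHom I (r : ℂ) • f v
    rw [sliceHom_ofReal, ← smul_one_smul ℍ[ℝ] r (f v)]
    congr 1
    ext <;> simp
  left_inv _ := rfl
  right_inv _ := rfl
  norm_map' _ := rfl

theorem toSliceOp_mul (f g : V →L[ℝ] V) : toSliceOp I (f * g) = toSliceOp I f * toSliceOp I g := rfl

theorem toSliceOp_one : toSliceOp I (1 : V →L[ℝ] V) = 1 := rfl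

instance : SMulCommClass ℝ (SliceOp I V) (SliceOp I V) := ⟨fun r f g => by
  obtain ⟨f, rfl⟩ := (toSliceOp I).surjective f
  obtain ⟨g, rfl⟩ := (toSliceOp I).surjective g
  rw [smul_eq_mul, smul_eq_mul, ← map_smul, ← toSliceOp_mul, ← toSliceOp_mul, ← map_smul,
    mul_smul_comm]⟩

theorem toSliceOp_pow (f : V →L[ℝ] V) (n : ℕ) : toSliceOp I (f ^ n) = toSliceOp I f ^ n := rfl

theorem isUnit_toSliceOp_iff (f : V →L[ℝ] V) : IsUnit (toSliceOp I f) ↔ IsUnit f := Iff.rfl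

theorem toSliceOp_inverse (f : V →L[ℝ] V) :
    toSliceOp I (Ring.inverse f) = Ring.inverse (toSliceOp I f) := rfl

theorem toSliceOp_sliceHom_smul (z : ℂ) (f : V →L[ℝ] V) :
    toSliceOp I (sliceHom I z • f) = z • toSliceOp I f := rfl

end SliceOp

/-! ### Reduction to the bounded inverse of `T` -/

section Operator

variable {V : Type*} [NormedAddCommGroup V] [NormedSpace ℝ V]
  [Module ℍ[ℝ] V] [Module ℍ[ℝ]ᵐᵒᵖ V] [SMulCommClass ℍ[ℝ]ᵐᵒᵖ ℍ[ℝ] V]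
  [IsScalarTower ℝ ℍ[ℝ] V] [IsScalarTower ℝ ℍ[ℝ]ᵐᵒᵖ V]
  [NormSMulClass ℍ[ℝ] V] [NormSMulClass ℍ[ℝ]ᵐᵒᵖ V]

variable {T : V →ₗ.[ℍ[ℝ]ᵐᵒᵖ] V} {A : V →L[ℍ[ℝ]ᵐᵒᵖ] V}

theorem mem_opQ_domain_iff {s : ℍ[ℝ]} {v : V} :
    v ∈ (opQ s T).domain ↔ ∃ h : v ∈ T.domain, T ⟨v, h⟩ ∈ T.domain := by
  constructor
  · rintro ⟨⟨⟨w, hw, rfl⟩, -⟩, -⟩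
    exact ⟨w.2, hw⟩
  · rintro ⟨h, h'⟩
    exact ⟨⟨⟨⟨v, h⟩, h', rfl⟩, h⟩, trivial⟩

theorem opQ_apply {s : ℍ[ℝ]} {v : V} (h : v ∈ (opQ s T).domain) (h1 : v ∈ T.domain)
    (h2 : T ⟨v, h1⟩ ∈ T.domain) :
    opQ s T ⟨v, h⟩ = T ⟨T ⟨v, h1⟩, h2⟩ - (2 * s.re) • T ⟨v, h1⟩ + (‖s‖ ^ 2) • v := rfl

theorem IsBoundedInverse.unique {P : V →ₗ.[ℍ[ℝ]ᵐᵒᵖ] V} {B B' : V →L[ℍ[ℝ]ᵐᵒᵖ] V}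
    (hB : IsBoundedInverse P B) (hB' : IsBoundedInverse P B') : B = B' := by
  ext v
  obtain ⟨h, hv⟩ := hB'.1 v
  have := hB.2 ⟨B' v, h⟩
  rwa [hv] at this

theorem opMul_eq {B C : V →L[ℍ[ℝ]ᵐᵒᵖ] V} (h : ∀ v : V, ∃ hv : B v ∈ T.domain, C v = T ⟨B v, hv⟩) :
    opMul T B = C := by
  have key : ∃ C : V →L[ℍ[ℝ]ᵐᵒᵖ] V, ∀ v : V, ∃ hv : B v ∈ T.domain, C v = T ⟨B v, hv⟩ := ⟨C, h⟩
  rw [opMul, dif_pos key]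
  ext v
  obtain ⟨h1, h2⟩ := key.choose_spec v
  obtain ⟨h3, h4⟩ := h v
  rw [h2, h4]

theorem opMul_mul (hA : IsBoundedInverse T A) (Y : V →L[ℍ[ℝ]ᵐᵒᵖ] V) : opMul T (A * Y) = Y :=
  opMul_eq fun v => by
    obtain ⟨h, h'⟩ := hA.1 (Y v)
    exact ⟨h, h'.symm⟩

theorem opMul_neg_mul (hA : IsBoundedInverse T A) (Y : V →L[ℍ[ℝ]ᵐᵒᵖ] V) :
    opMul (-T) (A * Y) = -Y :=
  opMul_eq fun v => by
    obtain ⟨h, h'⟩ := hA.1 (Y v)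
    exact ⟨h, congrArg Neg.neg h'.symm⟩

/-- If `0` is in the `S`-resolvent set, then `T` has a bounded inverse. -/
theorem exists_isBoundedInverse [CompleteSpace V] (hT : IsClosed (T.graph : Set (V × V)))
    (h0 : (0 : ℍ[ℝ]) ∈ sResolventSet T) : ∃ A, IsBoundedInverse T A := by
  obtain ⟨B, hB1, hB2⟩ := h0
  have hQ : ∀ {v : V} (h : v ∈ (opQ 0 T).domain) (h1 : v ∈ T.domain) (h2 : T ⟨v, h1⟩ ∈ T.domain),
      opQ 0 T ⟨v, h⟩ = T ⟨T ⟨v, h1⟩, h2⟩ := fun h h1 h2 => by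
    rw [opQ_apply h h1 h2]; simp
  have hdom : ∀ v, B v ∈ T.domain := fun v => by
    obtain ⟨h, -⟩ := hB1 v
    exact (mem_opQ_domain_iff.1 h).1
  have hdom2 : ∀ v, T ⟨B v, hdom v⟩ ∈ T.domain := fun v => by
    obtain ⟨h, -⟩ := hB1 v
    exact (mem_opQ_domain_iff.1 h).2
  have hTT : ∀ v, T ⟨T ⟨B v, hdom v⟩, hdom2 v⟩ = v := fun v => by
    obtain ⟨h, hv⟩ := hB1 v
    rwa [hQ h (hdom v) (hdom2 v)] at hv
  -- If `T w = 0`, then `w` lies in the domain of `T²`, which is injective. This makes `T (T²)⁻¹` a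
  -- left inverse of `T` as well as a right one.
  have hinj : ∀ w : T.domain, T w = 0 → w = 0 := by
    intro w hw
    have hmem : T ⟨w.1, w.2⟩ ∈ T.domain := by rw [hw]; exact T.domain.zero_mem
    have hwQ : w.1 ∈ (opQ 0 T).domain := mem_opQ_domain_iff.2 ⟨w.2, hmem⟩
    have h1 := hB2 ⟨w.1, hwQ⟩
    have h2 : (⟨T ⟨w.1, w.2⟩, hmem⟩ : T.domain) = 0 := Subtype.ext hw
    rw [hQ hwQ w.2 hmem, h2, LinearPMap.map_zero, map_zero] at h1
    exact Subtype.ext h1.symm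
  have hA := opMul_apply hT hdom
  refine ⟨opMul T B, fun v => ?_, fun w => ?_⟩
  · have h : opMul T B v ∈ T.domain := by rw [hA]; exact hdom2 v
    have h' : (⟨opMul T B v, h⟩ : T.domain) = ⟨T ⟨B v, hdom v⟩, hdom2 v⟩ := Subtype.ext (hA v)
    exact ⟨h, by rw [h', hTT]⟩
  · have h := hinj (⟨T ⟨B (T w), hdom _⟩, hdom2 _⟩ - w) (by
      rw [LinearPMap.map_sub, hTT, sub_self])
    rw [hA]
    exact congrArg Subtype.val (sub_eq_zero.1 h)

/-- The element `1 - 2 Re(s) A + |s|² A²` of the ring of bounded right linear operators. -/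
def quadOp (A : V →L[ℍ[ℝ]ᵐᵒᵖ] V) (s : ℍ[ℝ]) : V →L[ℍ[ℝ]ᵐᵒᵖ] V :=
  1 - (2 * s.re) • A + (‖s‖ ^ 2) • (A * A)

theorem quadOp_apply (s : ℍ[ℝ]) (v : V) :
    quadOp A s v = v - (2 * s.re) • A v + (‖s‖ ^ 2) • A (A v) := rfl

/-- Formally, `Q_s(T) = q_s(A) T²` on `D(T²)`, so its inverse is `A² q_s(A)⁻¹`. -/
theorem isBoundedInverse_opQ (hA : IsBoundedInverse T A) {s : ℍ[ℝ]} {Y : V →L[ℍ[ℝ]ᵐᵒᵖ] V}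
    (h1 : quadOp A s * Y = 1) (h2 : Y * quadOp A s = 1) :
    IsBoundedInverse (opQ s T) (A * A * Y) := by
  constructor
  · intro v
    obtain ⟨h3, h4⟩ := hA.1 (A (Y v))
    obtain ⟨h5, h6⟩ := hA.1 (Y v)
    have h7 : T ⟨A (A (Y v)), h3⟩ ∈ T.domain := by rw [h4]; exact h5
    have h8 : A (A (Y v)) ∈ (opQ s T).domain := mem_opQ_domain_iff.2 ⟨h3, h7⟩
    refine ⟨h8, ?_⟩
    change opQ s T ⟨A (A (Y v)), h8⟩ = v
    have h9 : (⟨T ⟨A (A (Y v)), h3⟩, h7⟩ : T.domain) = ⟨A (Y v), h5⟩ := Subtype.ext h4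
    rw [opQ_apply h8 h3 h7, h9, h6, h4]
    exact DFunLike.congr_fun h1 v
  · rintro ⟨w, hw⟩
    obtain ⟨h3, h4⟩ := mem_opQ_domain_iff.1 hw
    have h5 := hA.2 ⟨w, h3⟩
    have h6 := hA.2 ⟨_, h4⟩
    have h7 : opQ s T ⟨w, hw⟩ = quadOp A s (T ⟨_, h4⟩) := by
      rw [opQ_apply hw h3 h4, quadOp_apply, h6, h5]
    have h8 : Y (quadOp A s (T ⟨_, h4⟩)) = T ⟨_, h4⟩ := DFunLike.congr_fun h2 _
    change A (A (Y (opQ s T ⟨w, hw⟩))) = w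
    rw [h7, h8, h6, h5]

theorem mem_sResolventSet_iff [CompleteSpace V] (hT : IsClosed (T.graph : Set (V × V)))
    (hA : IsBoundedInverse T A) {s : ℍ[ℝ]} : s ∈ sResolventSet T ↔ IsUnit (quadOp A s) := by
  constructor
  · rintro ⟨B, hB1, hB2⟩
    have hdom : ∀ v, B v ∈ T.domain := fun v => by
      obtain ⟨h, -⟩ := hB1 v
      exact (mem_opQ_domain_iff.1 h).1
    have hdom2 : ∀ v, T ⟨B v, hdom v⟩ ∈ T.domain := fun v => by
      obtain ⟨h, -⟩ := hB1 v
      exact (mem_opQ_domain_iff.1 h).2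
    have h1 := opMul_apply hT hdom
    have hdom3 : ∀ v, opMul T B v ∈ T.domain := fun v => by rw [h1]; exact hdom2 v
    have h2 := opMul_apply hT hdom3
    have h3 : ∀ v, opMul T (opMul T B) v = T ⟨T ⟨B v, hdom v⟩, hdom2 v⟩ := fun v => by
      rw [h2]
      congr 1
      exact Subtype.ext (h1 v)
    -- The inverse of `q_s(A)` is `T² Q_s(T)⁻¹`, bounded by two applications of the closed graph
    -- theorem.
    refine ⟨⟨quadOp A s, opMul T (opMul T B), ?_, ?_⟩, rfl⟩
    · ext v
      obtain ⟨h, hv⟩ := hB1 v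
      change quadOp A s (opMul T (opMul T B) v) = v
      rw [h3, quadOp_apply, hA.2 ⟨_, hdom2 v⟩, hA.2 ⟨_, hdom v⟩]
      rwa [opQ_apply h (hdom v) (hdom2 v)] at hv
    · ext v
      obtain ⟨h4, h5⟩ := hA.1 (A v)
      obtain ⟨h6, h7⟩ := hA.1 v
      have h8 : T ⟨A (A v), h4⟩ ∈ T.domain := by rw [h5]; exact h6
      have h9 : A (A v) ∈ (opQ s T).domain := mem_opQ_domain_iff.2 ⟨h4, h8⟩
      have h10 : (⟨T ⟨A (A v), h4⟩, h8⟩ : T.domain) = ⟨A v, h6⟩ := Subtype.ext h5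
      have h11 : opQ s T ⟨A (A v), h9⟩ = quadOp A s v := by
        rw [opQ_apply h9 h4 h8, h10, h7, h5, quadOp_apply]
      have h12 := hB2 ⟨A (A v), h9⟩
      rw [h11] at h12
      change opMul T (opMul T B) (quadOp A s v) = v
      rw [h3]
      have h13 : (⟨B (quadOp A s v), hdom _⟩ : T.domain) = ⟨A (A v), h4⟩ := Subtype.ext h12
      have h14 : (⟨T ⟨B (quadOp A s v), hdom _⟩, hdom2 _⟩ : T.domain) = ⟨A v, h6⟩ :=

        Subtype.ext ((congrArg (fun w : T.domain => T w) h13).trans h5)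
      rw [h14, h7]
  · intro h
    exact ⟨_, isBoundedInverse_opQ hA (Ring.mul_inverse_cancel _ h) (Ring.inverse_mul_cancel _ h)⟩

theorem pseudoResolvent_eq (hA : IsBoundedInverse T A) {s : ℍ[ℝ]} (hs : IsUnit (quadOp A s)) :
    pseudoResolvent s T = A * A * Ring.inverse (quadOp A s) := by
  have h := isBoundedInverse_opQ hA (Ring.mul_inverse_cancel _ hs) (Ring.inverse_mul_cancel _ hs)
  exact (pseudoResolvent_spec ⟨_, h⟩).unique h

theorem sResolventR_eq (hA : IsBoundedInverse T A) {s : ℍ[ℝ]} (hs : IsUnit (quadOp A s)) :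
    sResolventR s T = star s • (A * A * Ring.inverse (quadOp A s)) -
      A * Ring.inverse (quadOp A s) := by
  rw [sResolventR, pseudoResolvent_eq hA hs, mul_assoc, opMul_mul hA, neg_sub]

theorem sResolventRPow_one (hA : IsBoundedInverse T A) {s : ℍ[ℝ]} (hs : IsUnit (quadOp A s)) :
    sResolventRPow 1 s T = sResolventR s T := by
  rw [sResolventR_eq hA hs, sResolventRPow, Finset.sum_range_succ, Finset.sum_range_one]
  simp only [Function.iterate_zero, id, Function.iterate_one, pow_one, Nat.choose_self,
    Nat.choose_zero_right, one_smul, Nat.sub_zero, Nat.sub_self, pow_zero]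
  rw [pseudoResolvent_eq hA hs, mul_assoc, opMul_neg_mul hA, sub_eq_add_neg]

theorem iterate_opMul_neg (hA : IsBoundedInverse T A) (Y : V →L[ℍ[ℝ]ᵐᵒᵖ] V) (k m : ℕ) :
    (opMul (-T))^[k] (A ^ (k + m) * Y) = (-1) ^ k * (A ^ m * Y) := by
  induction k generalizing Y with
  | zero => simp
  | succ k ih =>
    have h : -(A ^ (k + m) * Y) = A ^ (k + m) * -Y :=
      ContinuousLinearMap.ext fun x => (map_neg (A ^ (k + m)) (Y x)).symm
    have h' : A ^ m * -Y = -1 * (A ^ m * Y) :=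
      ContinuousLinearMap.ext fun x => map_neg (A ^ m) (Y x)
    rw [Function.iterate_succ_apply, show k + 1 + m = (k + m) + 1 by ring, pow_succ', mul_assoc,
      opMul_neg_mul hA, h, ih, h', ← mul_assoc, ← pow_succ]

/-- Restriction of scalars to `ℝ`, as a ring homomorphism. -/
def restrictHom : (V →L[ℍ[ℝ]ᵐᵒᵖ] V) →+* (V →L[ℝ] V) where
  toFun f := f.restrictScalars ℝ
  map_one' := rfl
  map_mul' _ _ := rfl
  map_zero' := rfl
  map_add' _ _ := rfl

theorem restrictHom_injective : Function.Injective (restrictHom (V := V)) := fun _ _ h =>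
  ContinuousLinearMap.ext fun v => DFunLike.congr_fun h v

theorem restrictHom_quaternion_smul (q : ℍ[ℝ]) (f : V →L[ℍ[ℝ]ᵐᵒᵖ] V) :
    restrictHom (q • f) = q • restrictHom f := rfl

theorem restrictHom_quadOp (s : ℍ[ℝ]) : restrictHom (quadOp A s) =
    1 - (2 * s.re) • restrictHom A + (‖s‖ ^ 2) • (restrictHom A * restrictHom A) := rfl

theorem coe_smul_eq (r : ℝ) (f : V →L[ℝ] V) : (r : ℍ[ℝ]) • f = r • f := by
  ext v
  change (r : ℍ[ℝ]) • f v = r • f v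
  rw [← smul_one_smul ℍ[ℝ] r (f v)]
  congr 1
  ext <;> simp

/-- A real-linear inverse of a right linear bijection is automatically right linear, so
invertibility can be tested in the larger ring. -/
theorem isUnit_restrictHom_iff {f : V →L[ℍ[ℝ]ᵐᵒᵖ] V} : IsUnit (restrictHom f) ↔ IsUnit f := by
  refine ⟨fun h => ?_, fun h => h.map restrictHom⟩
  obtain ⟨⟨_, g, h1, h2⟩, rfl⟩ := h
  have h1' : ∀ v, f (g v) = v := fun v => DFunLike.congr_fun h1 v
  have h2' : ∀ v, g (f v) = v := fun v => DFunLike.congr_fun h2 v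
  let g' : V →L[ℍ[ℝ]ᵐᵒᵖ] V :=
    { toFun := g
      map_add' := g.map_add
      map_smul' := fun c v => by
        conv_lhs => rw [← h1' v, ← map_smul, h2']
        rfl
      cont := g.continuous }
  exact ⟨⟨f, g', ContinuousLinearMap.ext h1', ContinuousLinearMap.ext h2'⟩, rfl⟩

theorem restrictHom_inverse {f : V →L[ℍ[ℝ]ᵐᵒᵖ] V} (hf : IsUnit f) :
    restrictHom (Ring.inverse f) = Ring.inverse (restrictHom f) := by
  refine (hf.map restrictHom).mul_left_cancel ?_
  rw [← map_mul, Ring.mul_inverse_cancel _ hf, map_one,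
    Ring.mul_inverse_cancel _ (hf.map restrictHom)]

theorem quadOp_neg_real (t : ℝ) :
    restrictHom (quadOp A ((-t : ℝ) : ℍ[ℝ])) =
      (1 + t • restrictHom A) * (1 + t • restrictHom A) := by
  rw [restrictHom_quadOp, Quaternion.norm_coe, Real.norm_eq_abs, sq_abs, Quaternion.re_coe]
  simp only [mul_add, add_mul, smul_mul_assoc, mul_smul_comm, mul_one, one_mul]
  module

/-- With `u = 1 + t A`, one has `Q_{-t}(T)^{-m} = A^{2m} u^{-2m}`. Each `(-T)^k` strips `k` factors
`A`, and the sum becomes `(-1)^m A^m (1 + t A)^m u^{-2m}` by the binomial theorem. -/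
theorem restrictHom_sResolventRPow_neg_real (hA : IsBoundedInverse T A) {t : ℝ}
    (ht : IsUnit (1 + t • restrictHom A)) (m : ℕ) :
    restrictHom (sResolventRPow m ((-t : ℝ) : ℍ[ℝ]) T) =
      (-1 : ℝ) ^ m • (restrictHom A * Ring.inverse (1 + t • restrictHom A)) ^ m := by
  have hq : IsUnit (quadOp A ((-t : ℝ) : ℍ[ℝ])) := by
    rw [← isUnit_restrictHom_iff, quadOp_neg_real]
    exact ht.mul ht
  set a := restrictHom A with ha
  set u := 1 + t • a with hu
  set Z := Ring.inverse (quadOp A ((-t : ℝ) : ℍ[ℝ])) with hZ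
  set v := Ring.inverse u with hv
  have hcau : Commute a u := (Commute.one_right a).add_right ((Commute.refl a).smul_right t)
  have hcav : Commute a v := by
    refine ht.mul_left_cancel ?_
    rw [← mul_assoc, ← hcau.eq, mul_assoc, Ring.mul_inverse_cancel _ ht, ← mul_assoc,
      Ring.mul_inverse_cancel _ ht, one_mul, mul_one]
  have hcuv : Commute u v := by
    rw [Commute, SemiconjBy, hv, Ring.mul_inverse_cancel _ ht, Ring.inverse_mul_cancel _ ht]
  have hZv : restrictHom Z = v * v := by
    rw [hZ, restrictHom_inverse hq, quadOp_neg_real, Ring.mul_inverse_rev' (Commute.refl _)]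
  have hcAq : Commute A (quadOp A ((-t : ℝ) : ℍ[ℝ])) := by
    refine restrictHom_injective ?_
    rw [map_mul, map_mul, quadOp_neg_real]
    exact (hcau.mul_right hcau).eq
  have hcAZ : Commute (A * A) Z := by
    have : Commute A Z := by
      refine hq.mul_left_cancel ?_
      rw [← mul_assoc, ← hcAq.eq, mul_assoc, Ring.mul_inverse_cancel _ hq, ← mul_assoc,
        Ring.mul_inverse_cancel _ hq, one_mul, mul_one]
    exact this.mul_left this
  have hpow : pseudoResolvent ((-t : ℝ) : ℍ[ℝ]) T ^ m = A ^ (2 * m) * Z ^ m := by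
    rw [pseudoResolvent_eq hA hq, hcAZ.mul_pow, ← pow_two, ← pow_mul]
  have hterm : ∀ k ∈ Finset.range (m + 1),
      restrictHom (m.choose k • (star ((-t : ℝ) : ℍ[ℝ])) ^ (m - k) •
        (opMul (-T))^[k] (pseudoResolvent ((-t : ℝ) : ℍ[ℝ]) T ^ m)) =
      (-1 : ℝ) ^ m • (a ^ m * (1 ^ k * (t • a) ^ (m - k) * (m.choose k : V →L[ℝ] V)) *
        (v * v) ^ m) := by
    intro k hk
    have hkm : k ≤ m := Nat.lt_succ_iff.1 (Finset.mem_range.1 hk)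
    rw [map_nsmul, restrictHom_quaternion_smul, hpow, show 2 * m = k + (m + (m - k)) by omega,
      iterate_opMul_neg hA, Quaternion.star_coe, ← Quaternion.coe_pow, coe_smul_eq, map_mul,
      map_mul, map_pow, map_pow, map_pow, map_neg, map_one, hZv, ← ha]
    have h1 : ((-1 : V →L[ℝ] V)) ^ k = ((-1 : ℝ) ^ k) • 1 := by
      rw [← neg_one_smul ℝ (1 : V →L[ℝ] V), smul_pow, one_pow]
    have h2 : (-1 : ℝ) ^ m = (-1) ^ (m - k) * (-1) ^ k := by
      rw [← pow_add, Nat.sub_add_cancel hkm]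
    rw [h1, h2, smul_pow, one_pow, one_mul, pow_add, ← nsmul_eq_mul', neg_pow t]
    simp only [smul_mul_assoc, mul_smul_comm, one_mul, smul_smul,
      ← Nat.cast_smul_eq_nsmul ℝ]
    congr 1
    ring
  rw [sResolventRPow, map_sum, Finset.sum_congr rfl hterm, ← Finset.smul_sum, ← Finset.sum_mul,
    ← Finset.mul_sum, ← (Commute.one_left (t • a)).add_pow]
  congr 1
  rw [← hu, hcav.mul_pow, (Commute.refl v).mul_pow, mul_assoc, ← mul_assoc (u ^ m),
    ← hcuv.mul_pow, hv, Ring.mul_inverse_cancel _ ht, one_pow, one_mul]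

end Operator

/-! ### Translation between the `S`-resolvent and the slice rings -/

section Transfer

variable {V : Type*} [NormedAddCommGroup V] [NormedSpace ℝ V]
  [Module ℍ[ℝ] V] [Module ℍ[ℝ]ᵐᵒᵖ V] [SMulCommClass ℍ[ℝ]ᵐᵒᵖ ℍ[ℝ] V]
  [IsScalarTower ℝ ℍ[ℝ] V] [IsScalarTower ℝ ℍ[ℝ]ᵐᵒᵖ V]
  [NormSMulClass ℍ[ℝ] V] [NormSMulClass ℍ[ℝ]ᵐᵒᵖ V]

variable {T : V →ₗ.[ℍ[ℝ]ᵐᵒᵖ] V} {A : V →L[ℍ[ℝ]ᵐᵒᵖ] V} (I : imagUnits)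

theorem toSliceOp_setIntegral (f : ℝ → V →L[ℝ] V) (s : Set ℝ) :
    toSliceOp I (∫ t in s, f t) = ∫ t in s, toSliceOp I (f t) :=
  ((toSliceOp (V := V) I).toContinuousLinearEquiv.integral_comp_comm
    (μ := volume.restrict s) f).symm

theorem toSliceOp_intervalIntegral (f : ℝ → V →L[ℝ] V) (a b : ℝ) :
    toSliceOp I (∫ t in a..b, f t) = ∫ t in a..b, toSliceOp I (f t) := by
  rw [intervalIntegral, intervalIntegral, map_sub, toSliceOp_setIntegral, toSliceOp_setIntegral]

/-- The bounded operator `A`, as an element of the complex Banach ring of the slice `ℂ_I`. -/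
def sliceElem (A : V →L[ℍ[ℝ]ᵐᵒᵖ] V) : SliceOp I V := toSliceOp I (restrictHom A)

theorem quadElem_sliceElem (z : ℂ) :
    quadElem (sliceElem I A) z = toSliceOp I (restrictHom (quadOp A (sliceHom I z))) := by
  rw [restrictHom_quadOp, re_sliceHom, norm_sliceHom, map_add, map_sub, map_smul, map_smul,
    toSliceOp_mul, toSliceOp_one, quadElem, sliceElem]

theorem isUnit_quadElem_sliceElem_iff {z : ℂ} :
    IsUnit (quadElem (sliceElem I A) z) ↔ IsUnit (quadOp A (sliceHom I z)) := by
  rw [quadElem_sliceElem, isUnit_toSliceOp_iff, isUnit_restrictHom_iff]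

theorem resolventFun_sliceElem (hA : IsBoundedInverse T A) {z : ℂ}
    (hz : IsUnit (quadOp A (sliceHom I z))) :
    resolventFun (sliceElem I A) z = toSliceOp I (restrictHom (sResolventR (sliceHom I z) T)) := by
  rw [resolventFun, quadElem_sliceElem, sResolventR_eq hA hz, map_sub, restrictHom_quaternion_smul,
    map_mul, map_mul, map_mul, restrictHom_inverse hz, map_sub, star_sliceHom,
    toSliceOp_sliceHom_smul, toSliceOp_mul, toSliceOp_mul, toSliceOp_mul, toSliceOp_inverse,
    sub_mul, sub_mul, one_mul, smul_mul_assoc, smul_mul_assoc, sliceElem]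

theorem one_add_smul_sliceElem (t : ℝ) :
    1 + t • sliceElem I A = toSliceOp I (1 + t • restrictHom A) := by
  rw [map_add, map_smul, toSliceOp_one, sliceElem]

theorem realResolvent_sliceElem (t : ℝ) : realResolvent (sliceElem I A) t =
    toSliceOp I (restrictHom A * Ring.inverse (1 + t • restrictHom A)) := by
  rw [realResolvent, one_add_smul_sliceElem, toSliceOp_mul, toSliceOp_inverse, sliceElem]

theorem neg_real_mem_negHalfLine {t : ℝ} (ht : 0 ≤ t) : ((-t : ℝ) : ℍ[ℝ]) ∈ negHalfLine :=
  ⟨-t, by linarith, rfl⟩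

/-- The square of `1 + t A` is invertible because `-t ∈ ρ_S(T)`, and a factor of an invertible
product of commuting elements is invertible. -/
theorem isUnit_one_add_smul [CompleteSpace V] (hT : IsPositiveType T) (hA : IsBoundedInverse T A)
    {t : ℝ} (ht : 0 ≤ t) : IsUnit (1 + t • restrictHom A) := by
  have h := (mem_sResolventSet_iff hT.closed hA).1 (hT.subset (neg_real_mem_negHalfLine ht))
  have h2 := h.map (restrictHom (V := V))
  rw [quadOp_neg_real] at h2
  exact ((Commute.refl _).isUnit_mul_iff.1 h2).1

theorem isUnit_one_add_smul_sliceElem [CompleteSpace V] (hT : IsPositiveType T)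
    (hA : IsBoundedInverse T A) {t : ℝ} (ht : 0 ≤ t) : IsUnit (1 + t • sliceElem I A) := by
  rw [one_add_smul_sliceElem, isUnit_toSliceOp_iff]
  exact isUnit_one_add_smul hT hA ht

theorem sliceHom_neg_real (t : ℝ) : sliceHom I (-(t : ℂ)) = ((-t : ℝ) : ℍ[ℝ]) := by
  rw [← sliceHom_ofReal I, Complex.ofReal_neg]

/-- The bound of the standing assumption, with a constant `M ≥ 1`. -/
theorem exists_norm_realResolvent_le [CompleteSpace V] (hT : IsPositiveType T)
    (hA : IsBoundedInverse T A) :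
    ∃ M : ℝ, 1 ≤ M ∧ ∀ (I : imagUnits) (t : ℝ), 0 ≤ t →
      ‖realResolvent (sliceElem I A) t‖ ≤ M / (1 + t) := by
  obtain ⟨M, -, hM⟩ := hT.bound
  refine ⟨max M 1, le_max_right _ _, fun I t ht => ?_⟩
  have h1 := resolventFun_neg_real (sliceElem I A) (isUnit_one_add_smul_sliceElem I hT hA ht)
  have hq : IsUnit (quadOp A (sliceHom I (-(t : ℂ)))) := by
    rw [sliceHom_neg_real]
    exact (mem_sResolventSet_iff hT.closed hA).1 (hT.subset (neg_real_mem_negHalfLine ht))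
  have h2 : ‖realResolvent (sliceElem I A) t‖ = ‖restrictHom (sResolventR ((-t : ℝ) : ℍ[ℝ]) T)‖ := by
    rw [← norm_neg, realResolvent, ← h1, resolventFun_sliceElem I hA hq,
      LinearIsometryEquiv.norm_map, sliceHom_neg_real]
  rw [h2]
  refine (hM _ (neg_real_mem_negHalfLine ht)).trans ?_
  rw [Quaternion.norm_coe, Real.norm_eq_abs, abs_neg, abs_of_nonneg ht]
  gcongr
  exact le_max_left _ _

/-- The sector constants depend only on `M`, which is the same in every slice; hence the slices
together fill a sector in `ℍ`. -/
theorem exists_isResolventSector [CompleteSpace V] (hT : IsPositiveType T)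
    (hA : IsBoundedInverse T A) : ∃ θ₀ a₀ : ℝ, IsResolventSector T θ₀ a₀ := by
  obtain ⟨M, hM1, hM⟩ := exists_norm_realResolvent_le hT hA
  have hM0 : 0 < M := by linarith
  obtain ⟨hc1, hc2⟩ := sectorCos_mem_Ioo hM0
  have hcos : Real.cos (Real.arccos (sectorCos M)) = sectorCos M :=
    Real.cos_arccos hc1.le (by linarith)
  have h0 : 0 < Real.arccos (sectorCos M) := Real.arccos_pos.2 (by linarith)
  have hπ : Real.arccos (sectorCos M) < Real.pi := by
    refine lt_of_le_of_ne (Real.arccos_le_pi _) fun h => ?_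
    rw [h, Real.cos_pi] at hcos
    linarith
  have key : ∀ s ∈ closedSector (Real.arccos (sectorCos M)) (1 / (16 * M)),
      s ∈ sResolventSet T ∧ ‖restrictHom (sResolventR s T)‖ ≤ 6 * M / (1 + ‖s‖) := by
    intro s hs
    obtain ⟨J, z, rfl⟩ := exists_sliceHom_eq s
    rw [sliceHom_mem_closedSector_iff J h0 hπ, hcos] at hs
    obtain ⟨h1, h2⟩ := isUnit_quadElem_and_norm_le_of_mem_sector
      (fun t ht => isUnit_one_add_smul_sliceElem J hT hA ht) hM1 (hM J) z hs
    rw [isUnit_quadElem_sliceElem_iff] at h1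
    rw [resolventFun_sliceElem J hA h1, LinearIsometryEquiv.norm_map] at h2
    rw [norm_sliceHom]
    exact ⟨(mem_sResolventSet_iff hT.closed hA).2 h1, h2⟩
  exact ⟨_, _, by positivity, h0, hπ, fun s hs => (key s hs).1, 6 * M, by positivity,
    fun s hs => (key s hs).2⟩

end Transfer

/-! ### Existence of admissible paths -/

section Path

theorem tendsto_norm_add_smul {l : Filter ℝ} {x : ℝ → ℝ} (hx : Tendsto x l atTop) {a w : ℂ}
    (hw : ‖w‖ = 1) : Tendsto (fun t => ‖a + x t • w‖) l atTop := by
  refine tendsto_atTop_mono' l ?_ (tendsto_atTop_add_const_right l (-‖a‖) hx)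
  filter_upwards [hx.eventually_ge_atTop 0] with t ht
  have h1 : ‖x t • w‖ = x t := by rw [norm_smul, hw, mul_one, Real.norm_of_nonneg ht]
  have h2 := norm_sub_le (a + x t • w) a
  rw [add_sub_cancel_left, h1] at h2
  linarith

theorem tendsto_inv_norm_smul_add_smul {l : Filter ℝ} {x : ℝ → ℝ} (hx : Tendsto x l atTop)
    {a w : ℂ} (hw : ‖w‖ = 1) :
    Tendsto (fun t => ‖a + x t • w‖⁻¹ • (a + x t • w)) l (𝓝 w) := by
  have h1 : Tendsto (fun t => (x t)⁻¹ • a + w) l (𝓝 w) := by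
    simpa using ((tendsto_inv_atTop_zero.comp hx).smul_const a).add_const w
  have h2 := (h1.norm.inv₀ (by rw [hw]; exact one_ne_zero)).smul h1
  rw [hw, inv_one, one_smul] at h2
  refine h2.congr' ?_
  filter_upwards [hx.eventually_gt_atTop 0] with t ht
  have h3 : (x t)⁻¹ • a + w = (x t)⁻¹ • (a + x t • w) := by
    rw [smul_add, inv_smul_smul₀ ht.ne']
  rw [h3, norm_smul, norm_inv, Real.norm_of_nonneg ht.le, smul_smul, mul_inv, inv_inv,
    mul_right_comm, mul_inv_cancel₀ ht.ne', one_mul]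

variable {V : Type*} [NormedAddCommGroup V] [NormedSpace ℝ V]
  [Module ℍ[ℝ] V] [Module ℍ[ℝ]ᵐᵒᵖ V] [SMulCommClass ℍ[ℝ]ᵐᵒᵖ ℍ[ℝ] V]
  [IsScalarTower ℝ ℍ[ℝ] V] [IsScalarTower ℝ ℍ[ℝ]ᵐᵒᵖ V]
  [NormSMulClass ℍ[ℝ] V] [NormSMulClass ℍ[ℝ]ᵐᵒᵖ V]

variable {T : V →ₗ.[ℍ[ℝ]ᵐᵒᵖ] V}

/-- The path `a + |t| e^{∓iθ}` that follows the boundary of a sector. -/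
def wedgePath (a θ : ℝ) (t : ℝ) : ℂ := ⟨a + |t| * Real.cos θ, -(t * Real.sin θ)⟩

theorem wedgePath_of_nonneg (a θ : ℝ) {t : ℝ} (ht : 0 ≤ t) :
    wedgePath a θ t = a + t • Complex.exp ((-θ : ℝ) * Complex.I) := by
  apply Complex.ext
  · rw [Complex.add_re, Complex.real_smul, Complex.re_ofReal_mul, Complex.exp_ofReal_mul_I_re]
    simp [wedgePath, abs_of_nonneg ht]
  · rw [Complex.add_im, Complex.real_smul, Complex.im_ofReal_mul, Complex.exp_ofReal_mul_I_im]
    simp [wedgePath]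

theorem wedgePath_of_nonpos (a θ : ℝ) {t : ℝ} (ht : t ≤ 0) :
    wedgePath a θ t = a + (-t) • Complex.exp (θ * Complex.I) := by
  apply Complex.ext
  · rw [Complex.add_re, Complex.real_smul, Complex.re_ofReal_mul, Complex.exp_ofReal_mul_I_re]
    simp [wedgePath, abs_of_nonpos ht]
  · rw [Complex.add_im, Complex.real_smul, Complex.im_ofReal_mul, Complex.exp_ofReal_mul_I_im]
    simp [wedgePath]

theorem exists_isAdmissiblePath {θ₀ a₀ : ℝ} (h : IsResolventSector T θ₀ a₀) (I : imagUnits) :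
    ∃ Γ, IsAdmissiblePath T I.1 Γ := by
  obtain ⟨ha, h0, hπ, -⟩ := id h
  -- The path follows the rays from the apex `a₀` at angles `±θ`, and crosses the real axis only at
  -- `a₀ > 0`.
  obtain ⟨θ, hθ0, hθπ⟩ := exists_between hπ
  have hsin : 0 < Real.sin θ := Real.sin_pos_of_pos_of_lt_pi (h0.trans hθ0) hθπ
  have hw1 : ‖Complex.exp (θ * Complex.I)‖ = 1 := Complex.norm_exp_ofReal_mul_I θ
  have hw2 : ‖Complex.exp ((-θ : ℝ) * Complex.I)‖ = 1 := Complex.norm_exp_ofReal_mul_I (-θ)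
  have hbot : (fun t : ℝ => (a₀ : ℂ) + (-t) • Complex.exp (θ * Complex.I)) =ᶠ[atBot]
      wedgePath a₀ θ := by
    filter_upwards [eventually_le_atBot 0] with t ht using (wedgePath_of_nonpos a₀ θ ht).symm
  have htop : (fun t : ℝ => (a₀ : ℂ) + t • Complex.exp ((-θ : ℝ) * Complex.I)) =ᶠ[atTop]
      wedgePath a₀ θ := by
    filter_upwards [eventually_ge_atTop 0] with t ht using (wedgePath_of_nonneg a₀ θ ht).symm
  have hnorm : ∀ t, ‖(sliceHom I (wedgePath a₀ θ t))‖⁻¹ • sliceHom I (wedgePath a₀ θ t) =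
      sliceHom I (‖wedgePath a₀ θ t‖⁻¹ • wedgePath a₀ θ t) := fun t => by
    rw [norm_sliceHom, map_smul]
  refine ⟨fun t => sliceHom I (wedgePath a₀ θ t), θ₀, a₀, θ, h, hθ0, hθπ, ⟨{0}, ?_⟩, ?_, ?_, ?_,
    ?_, ?_⟩
  · intro a b hab hP
    have hsm : ∀ w : ℂ, ContDiff ℝ 1 fun t : ℝ => sliceHom I ((a₀ : ℂ) + t • w) := fun w =>
      (LinearMap.toContinuousLinearMap (sliceHom I).toLinearMap).contDiff.comp
        (contDiff_const.add (contDiff_id.smul contDiff_const))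
    have h0P : ¬(a < 0 ∧ 0 < b) := fun hab' => hP 0 (by simp) hab'
    rcases le_or_gt 0 a with h1 | h1
    · refine (hsm (Complex.exp ((-θ : ℝ) * Complex.I))).contDiffOn.congr fun t ht => ?_
      rw [wedgePath_of_nonneg a₀ θ (h1.trans ht.1)]
    · have h2 : b ≤ 0 := not_lt.1 fun hb => h0P ⟨h1, hb⟩
      refine ((hsm (-Complex.exp (θ * Complex.I)))).contDiffOn.congr fun t ht => ?_
      rw [wedgePath_of_nonpos a₀ θ (ht.2.trans h2), neg_smul, smul_neg]
  · intro t
    refine ⟨⟨?_, (mem_slicePlane_iff I).2 ⟨_, rfl⟩⟩, ?_⟩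
    · rw [sliceHom_mem_closedSector_iff I h0 hπ]
      have h1 : ‖wedgePath a₀ θ t - a₀‖ = |t| := by
        rcases le_total 0 t with ht | ht
        · rw [wedgePath_of_nonneg a₀ θ ht, add_sub_cancel_left, norm_smul, hw2, mul_one,
            Real.norm_eq_abs]
        · rw [wedgePath_of_nonpos a₀ θ ht, add_sub_cancel_left, norm_smul, hw1, mul_one, norm_neg,
            Real.norm_eq_abs]
      change (wedgePath a₀ θ t).re - a₀ ≤ Real.cos θ₀ * ‖wedgePath a₀ θ t - a₀‖
      rw [h1]
      have h2 := Real.cos_le_cos_of_nonneg_of_le_pi h0.le hθπ.le hθ0.le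
      simp only [wedgePath, add_sub_cancel_left]
      nlinarith [abs_nonneg t]
    · rw [sliceHom_mem_negHalfLine_iff, not_not]
      by_cases ht : t = 0
      · left; simp [wedgePath, ht, ha]
      · right; simp [wedgePath, ht, hsin.ne']
  · simp only [norm_sliceHom]
    exact (tendsto_norm_add_smul tendsto_neg_atBot_atTop hw1).congr'
      (hbot.mono fun t ht => congrArg _ ht)
  · simp only [hnorm]
    rw [exp_smul_imagUnit]
    refine ((continuous_sliceHom I).tendsto _).comp
      ((tendsto_inv_norm_smul_add_smul tendsto_neg_atBot_atTop hw1 (a := a₀)).congr' ?_)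
    filter_upwards [hbot] with t ht
    rw [← ht]
  · simp only [norm_sliceHom]
    exact (tendsto_norm_add_smul tendsto_id hw2).congr' (htop.mono fun t ht => congrArg _ ht)
  · simp only [hnorm]
    rw [← neg_smul, exp_smul_imagUnit]
    refine ((continuous_sliceHom I).tendsto _).comp
      ((tendsto_inv_norm_smul_add_smul tendsto_id hw2 (a := a₀)).congr' ?_)
    filter_upwards [htop] with t ht
    rw [← ht]; rfl

end Path

/-! ### The integral formula, proved in a slice and carried back -/

section Main

variable {V : Type*} [NormedAddCommGroup V] [NormedSpace ℝ V]
  [Module ℍ[ℝ] V] [Module ℍ[ℝ]ᵐᵒᵖ V] [SMulCommClass ℍ[ℝ]ᵐᵒᵖ ℍ[ℝ] V]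
  [IsScalarTower ℝ ℍ[ℝ] V] [IsScalarTower ℝ ℍ[ℝ]ᵐᵒᵖ V]
  [NormSMulClass ℍ[ℝ] V] [NormSMulClass ℍ[ℝ]ᵐᵒᵖ V]

variable {T : V →ₗ.[ℍ[ℝ]ᵐᵒᵖ] V} {A : V →L[ℍ[ℝ]ᵐᵒᵖ] V}

theorem toSliceOp_sResolventRPow [CompleteSpace V] (hT : IsPositiveType T)
    (hA : IsBoundedInverse T A) (I : imagUnits) (m : ℕ) {t : ℝ} (ht : 0 ≤ t) :
    toSliceOp I (restrictHom (sResolventRPow m ((-t : ℝ) : ℍ[ℝ]) T)) =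
      (-1 : ℝ) ^ m • realResolvent (sliceElem I A) t ^ m := by
  rw [restrictHom_sResolventRPow_neg_real hA (isUnit_one_add_smul hT hA ht), map_smul,
    toSliceOp_pow, realResolvent_sliceElem]

theorem toSliceOp_rpow_smul_sResolventRPow [CompleteSpace V] (hT : IsPositiveType T)
    (hA : IsBoundedInverse T A) (I : imagUnits) (n : ℕ) (β : ℝ) {t : ℝ} (ht : 0 ≤ t) :
    toSliceOp I (t ^ β • restrictHom (sResolventRPow (n + 1) ((-t : ℝ) : ℍ[ℝ]) T)) =
      ((-1 : ℝ) ^ n / n.factorial) • (t ^ β • iteratedDeriv n (resolventFun (sliceElem I A)) (-t)) := by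
  rw [map_smul, toSliceOp_sResolventRPow hT hA I _ ht,
    iteratedDeriv_resolventFun_neg_real _ n (isUnit_one_add_smul_sliceElem I hT hA ht),
    ← neg_smul, smul_smul, smul_smul, smul_smul]
  congr 1
  have : (n.factorial : ℝ) ≠ 0 := by exact_mod_cast n.factorial_ne_zero
  field_simp
  ring

theorem integrableOn_rpow_smul_iteratedDeriv [CompleteSpace V] (hT : IsPositiveType T)
    (hA : IsBoundedInverse T A) (I : imagUnits) {n : ℕ} {α : ℝ} (hα0 : 0 < α) (hα : α < n + 1) :
    IntegrableOn (fun t : ℝ => t ^ ((n : ℝ) - α) •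
      iteratedDeriv n (resolventFun (sliceElem I A)) (-t)) (Set.Ioi 0) := by
  obtain ⟨M, -, hM⟩ := exists_norm_realResolvent_le hT hA
  have h := (integrableOn_rpow_smul_of_norm_le hα0 hα
    (continuousOn_realResolvent_pow (sliceElem I A)
      (fun t ht => isUnit_one_add_smul_sliceElem I hT hA ht) n)
    (fun t ht => norm_realResolvent_pow_le (hM I) n ht.le)).smul (-(n.factorial : ℝ))
  refine IntegrableOn.congr_fun h (fun t ht => ?_) measurableSet_Ioi
  rw [iteratedDeriv_resolventFun_neg_real _ n
    (isUnit_one_add_smul_sliceElem I hT hA (le_of_lt ht))]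
  simp only [Pi.smul_apply]
  rw [← neg_smul, smul_comm]

theorem integrableOn_rpow_smul_sResolventRPow [CompleteSpace V] (hT : IsPositiveType T)
    (hA : IsBoundedInverse T A) (I : imagUnits) {n : ℕ} {α : ℝ} (hα0 : 0 < α) (hα : α < n + 1) :
    IntegrableOn (fun t : ℝ => t ^ ((n : ℝ) - α) •
      restrictHom (sResolventRPow (n + 1) ((-t : ℝ) : ℍ[ℝ]) T)) (Set.Ioi 0) := by
  have h : IntegrableOn (fun t : ℝ => toSliceOp I (t ^ ((n : ℝ) - α) •
      restrictHom (sResolventRPow (n + 1) ((-t : ℝ) : ℍ[ℝ]) T))) (Set.Ioi 0) := by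
    refine IntegrableOn.congr_fun ((integrableOn_rpow_smul_iteratedDeriv hT hA I hα0 hα).smul
      ((-1 : ℝ) ^ n / n.factorial)) (fun t ht => ?_) measurableSet_Ioi
    exact (toSliceOp_rpow_smul_sResolventRPow hT hA I n _ (le_of_lt ht)).symm
  exact (toSliceOp (V := V) I).symm.toContinuousLinearEquiv.toContinuousLinearMap.integrable_comp h

theorem toSliceOp_fracPowIntegral [CompleteSpace V] (hT : IsPositiveType T)
    (hA : IsBoundedInverse T A) (I : imagUnits) (α : ℝ) {Γ : ℝ → ℍ[ℝ]} {γ : ℝ → ℂ}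
    {g : ℍ[ℝ] →L[ℝ] ℂ} (hg : ∀ z, g (sliceHom I z) = z) (hΓ : ∀ t, Γ t = sliceHom I (γ t))
    (hγ : ∀ t, γ t ∈ Complex.slitPlane) (hΓT : ∀ t, Γ t ∈ sResolventSet T) (a b : ℝ) :
    toSliceOp I (fracPowIntegral T α I.1 Γ a b) = (1 / (2 * Real.pi)) • ∫ t in a..b,
      (γ t ^ (-α : ℂ) * (-Complex.I * deriv γ t)) • resolventFun (sliceElem I A) (γ t) := by
  have hderiv : ∀ t, deriv Γ t = sliceHom I (deriv γ t) := by
    intro t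
    have h1 : Γ = fun t => LinearMap.toContinuousLinearMap (sliceHom I).toLinearMap (γ t) :=
      funext hΓ
    have h2 : γ = fun t => g (Γ t) := funext fun t => by rw [hΓ, hg]
    -- Differentiability of `Γ` and of `γ` at `t` are equivalent; where both fail, both derivatives
    -- have the default value `0`.
    by_cases h : DifferentiableAt ℝ γ t
    · have := (LinearMap.toContinuousLinearMap (sliceHom I).toLinearMap).hasFDerivAt.comp_hasDerivAt
        t h.hasDerivAt
      rw [h1]
      exact this.deriv
    · have h' : ¬DifferentiableAt ℝ Γ t := fun h' => h (by
        rw [h2]; exact g.differentiableAt.comp t h')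
      rw [deriv_zero_of_not_differentiableAt h, deriv_zero_of_not_differentiableAt h', map_zero]
  rw [fracPowIntegral, map_smul, toSliceOp_intervalIntegral]
  congr 1
  refine intervalIntegral.integral_congr fun t _ => ?_
  have hu : IsUnit (quadOp A (sliceHom I (γ t))) := by
    rw [← hΓ]
    exact (mem_sResolventSet_iff hT.closed hA).1 (hΓT t)
  rw [resolventFun_sliceElem I hA hu, ← toSliceOp_sliceHom_smul, hderiv, hΓ,
    qpow_sliceHom I (hγ t), map_mul, map_mul, map_neg, sliceHom_I, Complex.ofReal_neg]
  rfl

/-- The improper contour integral along an admissible path. -/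
theorem tendsto_fracPowIntegral [CompleteSpace V] (hT : IsPositiveType T)
    (hA : IsBoundedInverse T A) (I : imagUnits) {n : ℕ} {α : ℝ} (hα0 : 0 < α) (hα : α < n + 1)
    (hα' : ∀ m : ℕ, α ≠ m) {Γ : ℝ → ℍ[ℝ]} (hΓ : IsAdmissiblePath T I.1 Γ) :
    Tendsto (fun p : ℝ × ℝ => fracPowIntegral T α I.1 Γ p.1 p.2) (atBot ×ˢ atTop)
      (𝓝 (((-1 : ℝ) ^ (n + 1) * (Real.sin (α * Real.pi) / Real.pi) *
            ((n.factorial : ℝ) / ∏ j ∈ Finset.Icc 1 n, ((j : ℝ) - α))) •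
          ∫ t in Set.Ioi (0 : ℝ), t ^ ((n : ℝ) - α) •
            restrictHom (sResolventRPow (n + 1) ((-t : ℝ) : ℍ[ℝ]) T))) := by
  obtain ⟨θ₀, a₀, θ, ⟨ha, h0, hπ, hsub, M, -, hM⟩, hθ0, hθπ, ⟨P, hP⟩, hmem, hbot, hbot', htop,
    htop'⟩ := hΓ
  obtain ⟨g, hg⟩ := exists_leftInverse_sliceHom I
  set γ : ℝ → ℂ := fun t => g (Γ t) with hγdef
  have hΓγ : ∀ t, Γ t = sliceHom I (γ t) := by
    intro t
    obtain ⟨z, hz⟩ := (mem_slicePlane_iff I).1 (hmem t).1.2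
    rw [hγdef]
    simp only
    rw [← hz, hg]
  have hγs : ∀ t, γ t ∈ Complex.slitPlane := by
    intro t
    have := (hmem t).2
    rwa [hΓγ, sliceHom_mem_negHalfLine_iff, not_not] at this
  have hγc : ∀ t, γ t ∈ cone' (Real.cos θ₀) a₀ := by
    intro t
    have := (hmem t).1.1
    rwa [hΓγ, sliceHom_mem_closedSector_iff I h0 hπ] at this
  have hγP : ∀ a b : ℝ, a < b → (∀ t ∈ P, t ∉ Set.Ioo a b) → ContDiffOn ℝ 1 γ (Set.Icc a b) :=
    fun a b hab h => g.contDiff.comp_contDiffOn (hP a b hab h)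
  have hsec : ∀ z ∈ cone' (Real.cos θ₀) a₀, IsUnit (quadOp A (sliceHom I z)) := fun z hz =>
    (mem_sResolventSet_iff hT.closed hA).1 (hsub ((sliceHom_mem_closedSector_iff I h0 hπ).2 hz))
  have hγn : ∀ t, ‖Γ t‖ = ‖γ t‖ := fun t => by rw [hΓγ, norm_sliceHom]
  have hdir : ∀ {l : Filter ℝ} {w : ℂ}, Tendsto (fun t => ‖Γ t‖⁻¹ • Γ t) l (𝓝 (sliceHom I w)) →
      Tendsto (fun t => ‖γ t‖⁻¹ • γ t) l (𝓝 w) := by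
    intro l w h
    have h1 := (g.continuous.tendsto _).comp h
    rw [hg] at h1
    refine h1.congr fun t => ?_
    simp only [Function.comp_apply]
    rw [map_smul, hγn]
  have hc1 : -1 < Real.cos θ₀ := by
    rw [← Real.cos_pi]
    exact Real.cos_lt_cos_of_nonneg_of_le_pi h0.le le_rfl hπ
  have hc2 : Real.cos θ₀ < 1 := by
    rw [← Real.cos_zero]
    exact Real.cos_lt_cos_of_nonneg_of_le_pi le_rfl hπ.le h0
  have hcos : Real.cos θ < Real.cos θ₀ := Real.cos_lt_cos_of_nonneg_of_le_pi h0.le hθπ.le hθ0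
  have hsin : 0 < Real.sin θ := Real.sin_pos_of_pos_of_lt_pi (h0.trans hθ0) hθπ
  have hconj : starRingEnd ℂ (Complex.exp (θ * Complex.I)) =
      Complex.exp ((-θ : ℝ) * Complex.I) := by
    rw [← Complex.exp_conj, map_mul, Complex.conj_ofReal, Complex.conj_I]
    push_cast
    ring_nf
  rw [exp_smul_imagUnit] at hbot'
  rw [← neg_smul, exp_smul_imagUnit, ← hconj] at htop'
  simp only [hγn] at hbot htop
  have main := tendsto_contourIntegral (isOpen_isUnit_quadElem (sliceElem I A))
    (differentiableOn_resolventFun (sliceElem I A)) hα0 hα hα' hc1 hc2 ha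
    (fun z hz => (isUnit_quadElem_sliceElem_iff I).2 (hsec z hz))
    (M := M) (fun z hz => by
      rw [resolventFun_sliceElem I hA (hsec z hz), LinearIsometryEquiv.norm_map,
        ← norm_sliceHom I z]
      exact hM _ ((sliceHom_mem_closedSector_iff I h0 hπ).2 hz))
    (integrableOn_rpow_smul_iteratedDeriv hT hA I hα0 hα) hγP hγc hγs
    (u := Complex.exp (θ * Complex.I)) (by rwa [Complex.exp_ofReal_mul_I_re])
    (by rwa [Complex.exp_ofReal_mul_I_im]) hbot (hdir hbot') htop (hdir htop')
  have main2 := main.const_smul (1 / (2 * Real.pi))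
  simp_rw [← toSliceOp_fracPowIntegral hT hA I α hg hΓγ hγs (fun t => hsub (hmem t).1.1)] at main2
  have main3 := ((toSliceOp (V := V) I).symm.continuous.tendsto _).comp main2
  have hfun : ((toSliceOp (V := V) I).symm ∘ fun p : ℝ × ℝ =>
      toSliceOp I (fracPowIntegral T α I.1 Γ p.1 p.2)) =
      fun p : ℝ × ℝ => fracPowIntegral T α I.1 Γ p.1 p.2 :=
    funext fun p => (toSliceOp (V := V) I).symm_apply_apply _
  rw [hfun] at main3
  refine Eq.subst (motive := fun x => Tendsto _ _ (𝓝 x)) ?_ main3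
  rw [LinearIsometryEquiv.symm_apply_eq, map_smul, toSliceOp_setIntegral,
    setIntegral_congr_fun measurableSet_Ioi
      (fun t ht => toSliceOp_rpow_smul_sResolventRPow hT hA I n _ (le_of_lt ht)),
    integral_smul, smul_smul, smul_smul]
  -- The factor `(-1)^n / n!` from passing to `S_R^{-(n+1)}`, multiplied by the prefactor on the
  -- right, must match `(1 / 2π) · 2 (-1)^{n+1} sin(α π)` times `partsCoeff α n`.
  congr 1
  have hfac : (n.factorial : ℝ) ≠ 0 := by exact_mod_cast n.factorial_ne_zero
  have hprod : ∏ j ∈ Finset.Icc 1 n, ((j : ℝ) - α) ≠ 0 :=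
    Finset.prod_ne_zero_iff.2 fun j _ => sub_ne_zero.2 (hα' j).symm
  have hpi := Real.pi_ne_zero
  rw [partsCoeff]
  field_simp

theorem isNegFracPow_of_pow [CompleteSpace V] (hT : IsPositiveType T) (n : ℕ) (α : ℝ)
    (hα0 : 0 < α) (hα : α < n + 1) (hα' : ∀ m : ℕ, α ≠ m) :
    IntegrableOn (fun t : ℝ => t ^ ((n : ℝ) - α) •
        (sResolventRPow (n + 1) ((-t : ℝ) : ℍ[ℝ]) T).restrictScalars ℝ) (Set.Ioi 0) ∧
      IsNegFracPow T α
        (((-1 : ℝ) ^ (n + 1) * (Real.sin (α * Real.pi) / Real.pi) *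
            ((n.factorial : ℝ) / ∏ j ∈ Finset.Icc 1 n, ((j : ℝ) - α))) •
          ∫ t in Set.Ioi (0 : ℝ), t ^ ((n : ℝ) - α) •
            (sResolventRPow (n + 1) ((-t : ℝ) : ℍ[ℝ]) T).restrictScalars ℝ) := by
  obtain ⟨A, hA⟩ := exists_isBoundedInverse hT.closed (hT.subset ⟨0, le_rfl, by simp⟩)
  -- Integrability does not involve `I`, so any imaginary unit serves to prove it.
  obtain ⟨J, -, -⟩ := exists_sliceHom_eq 0
  refine ⟨integrableOn_rpow_smul_sResolventRPow hT hA J hα0 hα, fun I hI => ⟨?_, fun Γ hΓ => ?_⟩⟩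
  · obtain ⟨θ₀, a₀, h⟩ := exists_isResolventSector hT hA
    exact exists_isAdmissiblePath h ⟨I, hI⟩
  · exact tendsto_fracPowIntegral hT hA ⟨I, hI⟩ hα0 hα hα' hΓ

theorem sResolventRPow_one_neg_real [CompleteSpace V] (hT : IsPositiveType T) {t : ℝ}
    (ht : 0 ≤ t) :
    sResolventRPow 1 ((-t : ℝ) : ℍ[ℝ]) T = sResolventR ((-t : ℝ) : ℍ[ℝ]) T := by
  obtain ⟨A, hA⟩ := exists_isBoundedInverse hT.closed (hT.subset ⟨0, le_rfl, by simp⟩)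
  exact sResolventRPow_one hA
    ((mem_sResolventSet_iff hT.closed hA).1 (hT.subset (neg_real_mem_negHalfLine ht)))

end Main

end QuatOp

end

theorem mainTheorem4 {V : Type*} [NormedAddCommGroup V] [NormedSpace ℝ V] [CompleteSpace V]
    [Module ℍ[ℝ] V] [Module ℍ[ℝ]ᵐᵒᵖ V] [SMulCommClass ℍ[ℝ]ᵐᵒᵖ ℍ[ℝ] V]
    [IsScalarTower ℝ ℍ[ℝ] V] [IsScalarTower ℝ ℍ[ℝ]ᵐᵒᵖ V]
    [NormSMulClass ℍ[ℝ] V] [NormSMulClass ℍ[ℝ]ᵐᵒᵖ V]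
    (T : V →ₗ.[ℍ[ℝ]ᵐᵒᵖ] V) (hT : QuatOp.IsPositiveType T) :
    (∀ (n : ℕ) (α : ℝ), 0 < α → α < n + 1 → (∀ m : ℕ, α ≠ m) →
      IntegrableOn (fun t : ℝ => t ^ ((n : ℝ) - α) •
        (QuatOp.sResolventRPow (n + 1) ((-t : ℝ) : ℍ[ℝ]) T).restrictScalars ℝ) (Set.Ioi 0) ∧
      QuatOp.IsNegFracPow T α
        (((-1 : ℝ) ^ (n + 1) * (Real.sin (α * Real.pi) / Real.pi) *
            ((n.factorial : ℝ) / ∏ j ∈ Finset.Icc 1 n, ((j : ℝ) - α))) •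
          ∫ t in Set.Ioi (0 : ℝ), t ^ ((n : ℝ) - α) •
            (QuatOp.sResolventRPow (n + 1) ((-t : ℝ) : ℍ[ℝ]) T).restrictScalars ℝ)) ∧
    (∀ α : ℝ, 0 < α → α < 1 →
      IntegrableOn (fun t : ℝ => t ^ (-α) •
        (QuatOp.sResolventR ((-t : ℝ) : ℍ[ℝ]) T).restrictScalars ℝ) (Set.Ioi 0) ∧
      QuatOp.IsNegFracPow T α
        ((-(Real.sin (α * Real.pi) / Real.pi)) •
          ∫ t in Set.Ioi (0 : ℝ), t ^ (-α) •
            (QuatOp.sResolventR ((-t : ℝ) : ℍ[ℝ]) T).restrictScalars ℝ)) := by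

  refine ⟨fun n α => QuatOp.isNegFracPow_of_pow hT n α, fun α hα0 hα1 => ?_⟩
  have hα' : ∀ m : ℕ, α ≠ m := by
    rintro m rfl
    have h1 : 0 < m := by exact_mod_cast hα0
    have h2 : m < 1 := by exact_mod_cast hα1
    omega
  have h := QuatOp.isNegFracPow_of_pow hT 0 α hα0 (by simpa using hα1) hα'
  have heq : Set.EqOn (fun t : ℝ => t ^ (((0 : ℕ) : ℝ) - α) •
      (QuatOp.sResolventRPow (0 + 1) ((-t : ℝ) : ℍ[ℝ]) T).restrictScalars ℝ)
      (fun t : ℝ => t ^ (-α) •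
        (QuatOp.sResolventR ((-t : ℝ) : ℍ[ℝ]) T).restrictScalars ℝ) (Set.Ioi 0) := by
    intro t ht
    simp only
    rw [zero_add, QuatOp.sResolventRPow_one_neg_real hT (le_of_lt ht), Nat.cast_zero, zero_sub]
  refine ⟨h.1.congr_fun heq measurableSet_Ioi, ?_⟩
  have h2 := h.2
  rw [setIntegral_congr_fun measurableSet_Ioi heq] at h2
  simpa using h2
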